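/- All structures are finite. A relational structure $\mathcal A$ over a vocabulary $\tau$ (a finite set of relation symbols with arities) has a universe $A$ and relations $R^{\mathcal A}\subseteq A^{r}$ for each $R\in\tau$ of arity $r$. A homomorphism from $\mathcal A$ to $\mathcal B$ (over the same vocabulary) is a map $h:A\to B$ that maps every tuple of $R^{\mathcal A}$ into $R^{\mathcal B}$, for every $R\in\tau$. A substructure of $\mathcal A$ is a structure $\mathcal A'$ over $\tau$ with $A'\subseteq A$ and $R^{\mathcal A'}\subseteq R^{\mathcal A}$ for all $R\in\tau$; it is a core of $\mathcal A$ if there is a homomorphism from $\mathcal A$ to $\mathcal A'$ and there is none from $\mathcal A$ to a substructure $\mathcal A''\ne\mathcal A'$ of $\mathcal A'$. An ECSP instance is a triple $(\mathcal A,\mathcal B,O)$ where $\mathcal A,\mathcal B$ are structures over the same vocabulary and $O\subseteq A$; its solutions are the elements of $\mathcal A^{\mathcal B}[O]$, the set of the restrictions to $O$ of the homomorphisms from $\mathcal A$ to $\mathcal B$ (for $O=\emptyset$ there is one, empty, solution if a homomorphism exists, and none otherwise). For every variable $X$ there is a distinguished unary symbol $\mathrm{dom}(X)$; $\mathrm{drv}(\mathcal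 A)$ is the set of all $X\in A$ such that $\mathrm{dom}(X)\in\tau$ and $\mathrm{dom}(X)^{\mathcal A}=\{\langle X\rangle\}$. The hypergraph $\mathcal H_{\mathcal A}$ has the node set $A$ and, for each tuple of each relation of $\mathcal A$, the set of its elements as a hyperedge. A hypergraph is acyclic if it has a join tree: a tree whose vertices are the hyperedges, such that each node that occurs in two hyperedges occurs in all hyperedges on the path between them. Write $\mathcal H_1\le\mathcal H_2$ if each hyperedge of $\mathcal H_1$ is contained in a hyperedge of $\mathcal H_2$. The pair $(\mathcal H_1,\mathcal H_2)$ has a tree projection if there is an acyclic hypergraph $\mathcal H$ with $\mathcal H_1\le\mathcal H\le\mathcal H_2$. A view structure for $\mathcal A$ is a structure $\mathcal V$ with universe $A$, over a vocabulary disjoint from $\tau$, such that every relation of $\mathcal V$ consists of exactly one tuple, and such that for each $R\in\tau$ and $t\in R^{\mathcal A}$ there is a designated symbol $R_t$ of $\mathcal V$ (a base view) with $R_t^{\mathcal V}=\{t\}$. A structure $\mathcal W$ over the vocabulary of $\mathcal V$ is legal with respect to $\mathcal V$ and $(\mathcal A,\mathcal B)$ if, for each symbol $S$ of $\mathcal V$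 with $S^{\mathcal V}=\{w\}$ and each homomorphism $h$ from $\mathcal A$ to $\mathcal B$, one has $h(w)\in S^{\mathcal W}$, and if $R_t^{\mathcal W}\subseteq R^{\mathcal B}$ for all $R\in\tau$ and $t\in R^{\mathcal A}$. A decomposition method $\mathtt{DM}$ is a pair of polynomial-time computable functions $\ell\text{-}\mathtt{DM}$, $r\text{-}\mathtt{DM}$ such that, for all structures $\mathcal A,\mathcal B$ over the same vocabulary, $\ell\text{-}\mathtt{DM}(\mathcal A)$ is a view structure for $\mathcal A$, and $r\text{-}\mathtt{DM}(\mathcal A,\mathcal B)$ is legal with respect to $\ell\text{-}\mathtt{DM}(\mathcal A)$ and $(\mathcal A,\mathcal B)$. For $O\subseteq A$, let $\mathcal A\uplus\biguplus_{X\in O}\mathbb S_{\{X\}}$ be $\mathcal A$ together with, for each $X\in O$, a fresh unary symbol whose relation is $\{\langle X\rangle\}$. The pair $(\mathcal A,O)$ is tp-covered through $\mathtt{DM}$ if this structure has a core $\mathcal A'$ such that $(\mathcal H_{\mathcal A'},\mathcal H_{\ell\text{-}\mathtt{DM}(\mathcal A)})$ has a tree projection. Theorem. Let $\mathtt{DM}$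 be a decomposition method, and let $\mathbf A$ be any class of structures such that, for each $\mathcal A\in\mathbf A$, $(\mathcal A,\mathrm{drv}(\mathcal A))$ is tp-covered through $\mathtt{DM}$. Then the ECSP instances $(\mathcal A,\mathcal B,O)$ with $\mathcal A\in\mathbf A$, $\mathcal B$ any structure over the vocabulary of $\mathcal A$, and $O\subseteq\mathrm{drv}(\mathcal A)$, are solvable with polynomial delay: there are a (deterministic) algorithm and a polynomial $p$ such that on every such instance, of size $n$, the algorithm outputs each element of $\mathcal A^{\mathcal B}[O]$ exactly once and nothing else, and the time before the first output, between consecutive outputs, and from the last output until it halts is at most $p(n)$ (if there is no solution, the algorithm halts within time $p(n)$ without any output). (Algorithms are formalized as while-programs over binary trees, each evaluation of an expression being charged the sizes of all trees involved, so that running times are polynomially related to those of Turing machines.) -/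

import Mathlib

namespace ECSP

/-! ## Finite relational structures -/

/-- Types of relation symbols, each symbol having a specified arity. -/
class Vocabulary (σ : Type) extends LinearOrder σ where
  arity : σ → ℕ

/-- A finite relational structure: a finite universe, a finite vocabulary `vocab`, and for every
symbol `R` of the vocabulary a set `rel R` of tuples over the universe whose length is the arity of
`R`.  (For symbols outside of the vocabulary `rel` is empty by convention, so that a structure is
determined by its universe, its vocabulary and its relations.)  Elements are natural numbers. -/
@[ext]
structure RelStr (σ : Type) [Vocabulary σ] where
  univ : Finset ℕ
  vocab : Finset σ
  rel : σ → Finset (List ℕ)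
  length_eq : ∀ R, ∀ t ∈ rel R, t.length = Vocabulary.arity R
  mem_univ : ∀ R, ∀ t ∈ rel R, ∀ x ∈ t, x ∈ univ
  rel_eq_empty : ∀ R, R ∉ vocab → rel R = ∅

section Structures

variable {σ τ : Type} [Vocabulary σ] [Vocabulary τ]

/-- `h` (more precisely, its restriction to the universe of `A`) is a homomorphism from `A`
to `B`. -/
def IsHom (A B : RelStr σ) (h : ℕ → ℕ) : Prop :=
  (∀ x ∈ A.univ, h x ∈ B.univ) ∧ ∀ R ∈ A.vocab, ∀ t ∈ A.rel R, t.map h ∈ B.rel R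

/-- `A'` is a substructure of `A` (over the same vocabulary; not necessarily induced). -/
def IsSubstructure (A' A : RelStr σ) : Prop :=
  A'.vocab = A.vocab ∧ A'.univ ⊆ A.univ ∧ ∀ R ∈ A.vocab, A'.rel R ⊆ A.rel R

/-- `A'` is a core of `A`: a substructure to which `A` maps homomorphically, and that has no proper
substructure to which `A` maps homomorphically. -/
def IsCore (A' A : RelStr σ) : Prop :=
  IsSubstructure A' A ∧ (∃ h, IsHom A A' h) ∧
    ∀ A'', IsSubstructure A'' A' → (∃ h, IsHom A A'' h) → A'' = A'

/-- The disjoint union of two types of relation symbols (the order only serves to fix a listing of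
the symbols). -/
instance : Vocabulary (σ ⊕ τ) where
  toLinearOrder := inferInstanceAs (LinearOrder (σ ⊕ₗ τ))
  arity := Sum.elim Vocabulary.arity Vocabulary.arity

/-- `A ⊎ A'`: the structure over the disjoint union of the two vocabularies whose universe and whose
relations are those of `A` and of `A'` together. -/
def RelStr.disjUnion (A : RelStr σ) (A' : RelStr τ) : RelStr (σ ⊕ τ) where
  univ := A.univ ∪ A'.univ
  vocab := A.vocab.disjSum A'.vocab
  rel := Sum.elim A.rel A'.rel
  length_eq := by
    rintro (R | R) t ht
    · exact A.length_eq R t ht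
    · exact A'.length_eq R t ht
  mem_univ := by
    rintro (R | R) t ht x hx
    · exact Finset.mem_union_left _ (A.mem_univ R t ht x hx)
    · exact Finset.mem_union_right _ (A'.mem_univ R t ht x hx)
  rel_eq_empty := by
    rintro (R | R) hR
    · exact A.rel_eq_empty R (fun h => hR (Finset.inl_mem_disjSum.2 h))
    · exact A'.rel_eq_empty R (fun h => hR (Finset.inr_mem_disjSum.2 h))

end Structures

/-- The unary symbols `R_{X}`, one for each variable `X`, used to mark single variables. -/
structure MarkSymbol where
  var : ℕ

theorem MarkSymbol.var_injective : Function.Injective MarkSymbol.var := by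
  rintro ⟨a⟩ ⟨b⟩ h
  exact congrArg _ h

instance : Vocabulary MarkSymbol where
  toLinearOrder := LinearOrder.lift' MarkSymbol.var MarkSymbol.var_injective
  arity := fun _ => 1

/-- The structure `⊎_{X ∈ O} S_{X}`: its universe is `O`, and for each `X ∈ O` it has one unary symbol
`R_{X}`, whose relation contains just the tuple `⟨X⟩`. -/
def marks (O : Finset ℕ) : RelStr MarkSymbol where
  univ := O
  vocab := O.image MarkSymbol.mk
  rel := fun R => if R.var ∈ O then {[R.var]} else ∅
  length_eq := by
    intro R t ht
    split_ifs at ht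
    · rw [Finset.mem_singleton] at ht
      subst ht
      rfl
    · simp at ht
  mem_univ := by
    intro R t ht x hx
    split_ifs at ht with hR
    · rw [Finset.mem_singleton] at ht
      subst ht
      rw [List.mem_singleton] at hx
      exact hx ▸ hR
    · simp at ht
  rel_eq_empty := by
    intro R hR
    refine if_neg fun h => hR ?_
    exact Finset.mem_image.2 ⟨R.var, h, rfl⟩

/-- Relation symbols of the structures of constraint satisfaction instances (and of views):
ordinary symbols, and the distinguished unary domain symbols `dom(X)`. -/
inductive Symbol where
  | rel (name arity : ℕ)
  | dom (X : ℕ)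

/-- A symbol as a list of numbers. -/
def Symbol.toList : Symbol → List ℕ
  | .rel n k => [0, n, k]
  | .dom X => [1, X]

theorem Symbol.toList_injective : Function.Injective Symbol.toList := by
  rintro (⟨n, k⟩ | X) (⟨m, l⟩ | Y) h <;> simp_all [Symbol.toList]

instance : Vocabulary Symbol where
  toLinearOrder := LinearOrder.lift' Symbol.toList Symbol.toList_injective
  arity
    | .rel _ k => k
    | .dom _ => 1

/-- Structures over the symbols above. -/
abbrev Str := RelStr Symbol

/-- The set of the domain restricted variables of `A`: those `X` with `dom(X)` in the vocabulary and
`dom(X)^A = {⟨X⟩}`. -/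
def drv (A : Str) : Finset ℕ :=
  A.univ.filter fun X => Symbol.dom X ∈ A.vocab ∧ A.rel (Symbol.dom X) = {[X]}

/-! ## Hypergraphs and tree projections -/

structure Hypergraph where
  nodes : Finset ℕ
  edges : Finset (Finset ℕ)
  subset_nodes : ∀ e ∈ edges, e ⊆ nodes

/-- The hypergraph of a structure: a hyperedge for the set of variables of each tuple. -/
def hypergraph {σ : Type} [Vocabulary σ] (A : RelStr σ) : Hypergraph where
  nodes := A.univ
  edges := A.vocab.biUnion fun R => (A.rel R).image List.toFinset
  subset_nodes := by
    intro e he x hx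
    obtain ⟨R, -, he⟩ := Finset.mem_biUnion.1 he
    obtain ⟨t, ht, rfl⟩ := Finset.mem_image.1 he
    exact A.mem_univ R t ht x (List.mem_toFinset.1 hx)

/-- `T` is a join tree of `H`: a tree on the hyperedges of `H` such that every node occurring in two
hyperedges also occurs in all the hyperedges on the path that links them.  (The empty graph is the join
tree of a hypergraph without hyperedges.) -/
def IsJoinTree (H : Hypergraph) (T : SimpleGraph {e // e ∈ H.edges}) : Prop :=
  T.Preconnected ∧ T.IsAcyclic ∧
    ∀ (e f : {e // e ∈ H.edges}) (X : ℕ), X ∈ e.1 → X ∈ f.1 →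
      ∀ p : T.Walk e f, p.IsPath → ∀ g ∈ p.support, X ∈ g.1

def Hypergraph.Acyclic (H : Hypergraph) : Prop := ∃ T, IsJoinTree H T

/-- `H₁ ≤ H₂`: each hyperedge of `H₁` is contained in a hyperedge of `H₂`. -/
def Hypergraph.Below (H₁ H₂ : Hypergraph) : Prop := ∀ e ∈ H₁.edges, ∃ f ∈ H₂.edges, e ⊆ f

/-- The pair `(H₁, H₂)` has a tree projection. -/
def HasTreeProjection (H₁ H₂ : Hypergraph) : Prop :=
  ∃ H : Hypergraph, H.Acyclic ∧ H₁.Below H ∧ H.Below H₂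

/-! ## Views -/

/-- `V` is a view structure for `A`, where `base R t` is the base view of the constraint given by the
symbol `R` and the tuple `t ∈ R^A`. -/
structure IsViewStructure (A V : Str) (base : Symbol → List ℕ → Symbol) : Prop where
  univ_eq : V.univ = A.univ
  disjoint : Disjoint V.vocab A.vocab
  single : ∀ R ∈ V.vocab, ∃ t, V.rel R = {t}
  base_view : ∀ R ∈ A.vocab, ∀ t ∈ A.rel R, base R t ∈ V.vocab ∧ V.rel (base R t) = {t}

/-- `W` is legal with respect to the view structure `V` (with base views `base`) and `(A, B)`: its
vocabulary is that of `V`; every view contains the projections of all homomorphisms from `A` to `B`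
onto its variables; and every base view is contained in the relation of its constraint. -/
structure IsLegal (A B V W : Str) (base : Symbol → List ℕ → Symbol) : Prop where
  vocab_eq : W.vocab = V.vocab
  projection : ∀ R ∈ V.vocab, ∀ w ∈ V.rel R, ∀ h, IsHom A B h → w.map h ∈ W.rel R
  base_subset : ∀ R ∈ A.vocab, ∀ t ∈ A.rel R, W.rel (base R t) ⊆ B.rel R

/-! ## Machine model

Deterministic while-programs over binary trees.  A program has variables `0, 1, 2, …` that hold binary
trees, can build trees and take them apart, compare trees, assign to variables, branch, loop, and
write a tree to its output.  Every evaluation of an expression is charged the sizes of all the trees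
that occur in it (as if each of them were copied), so that running times are polynomially
related to those of Turing machines. -/

inductive Data where
  | nil
  | cons (a b : Data)
  deriving DecidableEq

namespace Data

/-- The number of vertices of a tree. -/
def size : Data → ℕ
  | nil => 1
  | cons a b => 1 + a.size + b.size

def hd : Data → Data
  | nil => nil
  | cons a _ => a

def tl : Data → Data
  | nil => nil
  | cons _ b => b

/-- The two truth values (in tests, `nil` is false and every other tree is true). -/
def ofBool : Bool → Data
  | false => nil
  | true => cons nil nil

end Data

/-- The contents of the variables. -/
abbrev Store := ℕ → Data

inductive Expr where
  | var (x : ℕ)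
  | nil
  | cons (e f : Expr)
  | hd (e : Expr)
  | tl (e : Expr)
  | eq (e f : Expr)

namespace Expr

def eval (s : Store) : Expr → Data
  | var x => s x
  | nil => .nil
  | cons e f => .cons (e.eval s) (f.eval s)
  | hd e => (e.eval s).hd
  | tl e => (e.eval s).tl
  | eq e f => .ofBool (decide (e.eval s = f.eval s))

/-- The time needed to evaluate an expression: the sum of the sizes of the values of all its
subexpressions. -/
def cost (s : Store) : Expr → ℕ
  | var x => (s x).size
  | nil => 1
  | cons e f => e.cost s + f.cost s + ((cons e f).eval s).size
  | hd e => e.cost s + ((hd e).eval s).size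
  | tl e => e.cost s + ((tl e).eval s).size
  | eq e f => e.cost s + f.cost s + ((eq e f).eval s).size

end Expr

inductive Prog where
  | assign (x : ℕ) (e : Expr)
  | emit (e : Expr)
  | seq (c d : Prog)
  | ite (e : Expr) (c d : Prog)
  | while (e : Expr) (c : Prog)

/-- Output: the list of the trees written, in this order, each one with the time at which it is
written. -/
abbrev Output := List (ℕ × Data)

/-- The output `L` of a computation that starts `k` time units later. -/
def Output.delay (k : ℕ) (L : Output) : Output := L.map fun o => (k + o.1, o.2)

/-- `Exec c s s' k L`: started with store `s`, the program `c` halts after `k` time units with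
store `s'`, having produced the output `L`. -/
inductive Exec : Prog → Store → Store → ℕ → Output → Prop
  | assign (x : ℕ) (e : Expr) (s : Store) :
      Exec (.assign x e) s (Function.update s x (e.eval s)) (e.cost s) []
  | emit (e : Expr) (s : Store) :
      Exec (.emit e) s s (e.cost s) [(e.cost s, e.eval s)]
  | seq {c d : Prog} {s s' s'' : Store} {k l : ℕ} {L M : Output} :
      Exec c s s' k L → Exec d s' s'' l M →
      Exec (.seq c d) s s'' (k + l) (L ++ M.delay k)
  | ite_true {e : Expr} {c d : Prog} {s s' : Store} {k : ℕ} {L : Output} :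
      e.eval s ≠ .nil → Exec c s s' k L →
      Exec (.ite e c d) s s' (e.cost s + k) (L.delay (e.cost s))
  | ite_false {e : Expr} {c d : Prog} {s s' : Store} {k : ℕ} {L : Output} :
      e.eval s = .nil → Exec d s s' k L →
      Exec (.ite e c d) s s' (e.cost s + k) (L.delay (e.cost s))
  | while_false {e : Expr} {c : Prog} {s : Store} :
      e.eval s = .nil → Exec (.while e c) s s (e.cost s) []
  | while_true {e : Expr} {c : Prog} {s s' s'' : Store} {k l : ℕ} {L M : Output} :
      e.eval s ≠ .nil → Exec c s s' k L → Exec (.while e c) s' s'' l M →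
      Exec (.while e c) s s'' (e.cost s + k + l)
        (L.delay (e.cost s) ++ M.delay (e.cost s + k))

/-- The initial store: the input is in variable `0`, all other variables hold `nil`. -/
def initStore (d : Data) : Store := Function.update (fun _ => Data.nil) 0 d

/-- `f` is computable in polynomial time on the arguments that satisfy `D`, with respect to the
encodings `encα` and `encβ`: the program halts with the value in variable `0`. -/
def PolyTimeComputableOn {α β : Type} (D : α → Prop) (encα : α → Data) (encβ : β → Data)
    (f : α → β) : Prop :=
  ∃ (c : Prog) (p : Polynomial ℕ), ∀ a, D a →
    ∃ (s : Store) (k : ℕ) (L : Output),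
      Exec c (initStore (encα a)) s k L ∧ s 0 = encβ (f a) ∧ k ≤ p.eval (encα a).size

/-- The problem of enumerating, for each instance `a` that satisfies `D`, the elements of `sol a` is
solvable with polynomial delay: one program outputs on each such input every solution exactly once
and nothing else; the time until the first output, the time between any two consecutive outputs, and
the time from the last output until the program halts are bounded by a polynomial in the size of the
input (if there is no solution, this is the time until the program halts). -/
def EnumerableWPDOn {α β : Type} (D : α → Prop) (encα : α → Data) (encβ : β → Data)
    (sol : α → Set β) : Prop :=
  ∃ (c : Prog) (p : Polynomial ℕ), ∀ a, D a →
    ∃ (s : Store) (k : ℕ) (L : Output),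
      Exec c (initStore (encα a)) s k L ∧
      (L.map Prod.snd).Nodup ∧
      (∀ d, d ∈ L.map Prod.snd ↔ ∃ y ∈ sol a, encβ y = d) ∧
      (0 :: (L.map Prod.fst ++ [k])).IsChain fun t u => u ≤ t + p.eval (encα a).size

/-! ## Encodings -/

def encList {α : Type} (enc : α → Data) : List α → Data
  | [] => .nil
  | a :: l => .cons (enc a) (encList enc l)

def encPair {α β : Type} (encα : α → Data) (encβ : β → Data) (x : α × β) : Data :=
  .cons (encα x.1) (encβ x.2)

/-- Numbers are encoded in binary. -/
def encNat (n : ℕ) : Data := encList Data.ofBool n.bits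

def encSymbol (R : Symbol) : Data := encList encNat R.toList

/-- Finite sets are encoded as increasing lists. -/
def encFinset {α : Type} [LinearOrder α] (enc : α → Data) (s : Finset α) : Data :=
  encList enc (s.sort (· ≤ ·))

/-- A structure is encoded by its universe and the list of its symbols with their relations. -/
def encStr (A : Str) : Data :=
  .cons (encFinset encNat A.univ)
    (encFinset (fun R => .cons (encSymbol R) (encFinset (encList encNat) (A.rel R))) A.vocab)

/-! ## Decomposition methods, instances, and the enumeration problem -/

/-- A decomposition method: a pair of polynomial-time computable functions that, given structures `A`
and `B` over the same vocabulary, compute a view structure `lDM A` for `A` and a structure `rDM A B` that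
is legal with respect to it and `(A, B)`. -/
structure DecompositionMethod where
  lDM : Str → Str
  rDM : Str → Str → Str
  base : Str → Symbol → List ℕ → Symbol
  lDM_polyTime : PolyTimeComputableOn (fun _ => True) encStr encStr lDM
  rDM_polyTime : PolyTimeComputableOn (fun I : Str × Str => I.2.vocab = I.1.vocab)
    (encPair encStr encStr) encStr fun I => rDM I.1 I.2
  isViewStructure : ∀ A, IsViewStructure A (lDM A) (base A)
  isLegal : ∀ A B : Str, B.vocab = A.vocab → IsLegal A B (lDM A) (rDM A B) (base A)

/-- `(A, O)` is tp-covered through `DM`. -/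
def TPCovered (DM : DecompositionMethod) (A : Str) (O : Finset ℕ) : Prop :=
  ∃ A' : RelStr (Symbol ⊕ MarkSymbol), IsCore A' (A.disjUnion (marks O)) ∧
    HasTreeProjection (hypergraph A') (hypergraph (DM.lDM A))

/-- An instance `(A, B, O)` of the enumeration problem. -/
structure Instance where
  A : Str
  B : Str
  O : Finset ℕ
  vocab_eq : B.vocab = A.vocab
  subset_univ : O ⊆ A.univ

def encInstance (I : Instance) : Data :=
  .cons (encStr I.A) (.cons (encStr I.B) (encFinset encNat I.O))

/-- The restriction of `h` to `O`, as the list of the pairs `(X, h X)` with `X ∈ O`, in increasing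
order of `X`. -/
def restrict (h : ℕ → ℕ) (O : Finset ℕ) : List (ℕ × ℕ) :=
  (O.sort (· ≤ ·)).map fun X => (X, h X)

/-- The set `A^B[O]` of the restrictions to `O` of the homomorphisms from `A` to `B`. -/
def solutions (I : Instance) : Set (List (ℕ × ℕ)) :=
  {r | ∃ h, IsHom I.A I.B h ∧ restrict h I.O = r}

/-- The enumeration problem restricted to the instances that satisfy `D` is solvable with polynomial
delay. -/
def SolvableWPD (D : Instance → Prop) : Prop :=
  EnumerableWPDOn D encInstance (encList (encPair encNat encNat)) solutions

end ECSP

namespace ECSP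

/-! ## Polynomially bounded quantities -/

/-- Types whose elements are encoded as binary trees. -/
class Enc (α : Type) where
  enc : α → Data

open Enc (enc)

/-- The size of the encoding. -/
def sz {α : Type} [Enc α] (a : α) : ℕ := (Enc.enc a).size

/-- `T` is bounded by a polynomial in the size of the argument. -/
def PolyBd {α : Type} [Enc α] (T : α → ℕ) : Prop :=
  ∃ p : Polynomial ℕ, ∀ a, T a ≤ p.eval (sz a)

theorem eval_mono (p : Polynomial ℕ) {m n : ℕ} (h : m ≤ n) : p.eval m ≤ p.eval n := by
  rw [Polynomial.eval_eq_sum_range, Polynomial.eval_eq_sum_range]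
  gcongr

namespace PolyBd

variable {α β : Type} [Enc α] [Enc β] {S T : α → ℕ}

theorem mono (hT : PolyBd T) (h : ∀ a, S a ≤ T a) : PolyBd S :=
  let ⟨p, hp⟩ := hT
  ⟨p, fun a => (h a).trans (hp a)⟩

theorem const (n : ℕ) : PolyBd fun _ : α => n := ⟨Polynomial.C n, fun a => by simp⟩

theorem size : PolyBd fun a : α => sz a := ⟨Polynomial.X, fun a => by simp⟩

theorem add (hS : PolyBd S) (hT : PolyBd T) : PolyBd fun a => S a + T a :=
  let ⟨p, hp⟩ := hS
  let ⟨q, hq⟩ := hT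
  ⟨p + q, fun a => by rw [Polynomial.eval_add]; exact add_le_add (hp a) (hq a)⟩

theorem mul (hS : PolyBd S) (hT : PolyBd T) : PolyBd fun a => S a * T a :=
  let ⟨p, hp⟩ := hS
  let ⟨q, hq⟩ := hT
  ⟨p * q, fun a => by rw [Polynomial.eval_mul]; exact Nat.mul_le_mul (hp a) (hq a)⟩

theorem eval (q : Polynomial ℕ) (hT : PolyBd T) : PolyBd fun a => q.eval (T a) :=
  let ⟨p, hp⟩ := hT
  ⟨q.comp p, fun a => by rw [Polynomial.eval_comp]; exact eval_mono q (hp a)⟩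

theorem comp {T : β → ℕ} (hT : PolyBd T) {f : α → β} (hf : PolyBd fun a => sz (f a)) :
    PolyBd fun a => T (f a) :=
  let ⟨p, hp⟩ := hT
  (hf.eval p).mono fun a => hp (f a)

end PolyBd

/-! ## Encodings of types -/

instance : Enc Data := ⟨id⟩

instance : Enc ℕ := ⟨encNat⟩

instance : Enc Bool := ⟨Data.ofBool⟩

instance : Enc Symbol := ⟨encSymbol⟩

instance : Enc Str := ⟨encStr⟩

instance : Enc Instance := ⟨encInstance⟩

section EncInstances

variable {α β : Type} [Enc α] [Enc β]

instance : Enc (List α) := ⟨encList enc⟩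

instance : Enc (α × β) := ⟨encPair enc enc⟩

instance {D : α → Prop} : Enc {a // D a} := ⟨fun a => enc a.1⟩

theorem enc_cons (a : α) (l : List α) : enc (a :: l) = .cons (enc a) (enc l) := rfl

theorem enc_pair (a : α) (b : β) : enc (a, b) = .cons (enc a) (enc b) := rfl

theorem sz_nil : sz ([] : List α) = 1 := rfl

theorem sz_cons (a : α) (l : List α) : sz (a :: l) = 1 + sz a + sz l := rfl

theorem sz_pair (a : α) (b : β) : sz (a, b) = 1 + sz a + sz b := rfl

theorem Data.size_pos (d : Data) : 0 < d.size := by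
  cases d <;> simp only [Data.size] <;> omega

theorem sz_bool (b : Bool) : sz b ≤ 3 := by cases b <;> decide

theorem sz_le_of_mem {a : α} {l : List α} (h : a ∈ l) : sz a < sz l := by
  induction l with
  | nil => simp at h
  | cons b l ih =>
    rw [sz_cons]
    rcases List.mem_cons.1 h with rfl | h
    · omega
    · have := ih h; omega

theorem length_lt_sz (l : List α) : l.length < sz l := by
  induction l with
  | nil => exact Nat.one_pos
  | cons b l ih => rw [sz_cons, List.length_cons]; omega

theorem enc_list_map {γ : Type} (f : γ → α) (l : List γ) :
    enc (l.map f) = encList (fun x => enc (f x)) l := by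
  induction l with
  | nil => rfl
  | cons a l ih => rw [List.map_cons, enc_cons, ih]; rfl

theorem sz_le_of_sublist {l l' : List α} (h : l.Sublist l') : sz l ≤ sz l' := by
  induction h with
  | slnil => rfl
  | cons a _ ih => rw [sz_cons]; omega
  | cons_cons a _ ih => rw [sz_cons, sz_cons]; omega

theorem sz_append (l l' : List α) : sz (l ++ l') + 1 = sz l + sz l' := by
  induction l with
  | nil => rw [List.nil_append, sz_nil]; omega
  | cons a l ih => rw [List.cons_append, sz_cons, sz_cons]; omega

theorem sz_le_of_forall {l : List α} {m : ℕ} (h : ∀ a ∈ l, sz a ≤ m) :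
    sz l ≤ 1 + l.length * (m + 1) := by
  induction l with
  | nil => simp [sz_nil]
  | cons a l ih =>
    have h1 := h a (by simp)
    have h2 := ih fun b hb => h b (by simp [hb])
    rw [sz_cons, List.length_cons, Nat.succ_mul]
    omega

theorem encList_injective {γ : Type} {f : γ → Data} (hf : f.Injective) :
    (encList f).Injective := by
  intro l
  induction l with
  | nil => rintro (_ | ⟨b, l'⟩) h <;> simp_all [encList]
  | cons a l ih =>
    rintro (_ | ⟨b, l'⟩) h
    · simp [encList] at h
    · simp only [encList, Data.cons.injEq] at h
      rw [hf h.1, ih h.2]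

theorem encNat_injective : encNat.Injective := by
  have hb : Data.ofBool.Injective := by
    intro a b; cases a <;> cases b <;> simp [Data.ofBool]
  have h : Nat.bits.Injective := by
    intro m n hmn
    apply Nat.eq_of_testBit_eq
    intro i
    rw [Nat.testBit_eq_inth, Nat.testBit_eq_inth, hmn]
  exact (encList_injective hb).comp h

theorem encSymbol_injective : encSymbol.Injective :=
  (encList_injective encNat_injective).comp Symbol.toList_injective

end EncInstances

/-! ## Functions computable in polynomial time -/

/-- Started with the store `s`, the program `c` halts within time `t`, without output and with a store
that satisfies `Q`. -/
def Runs (c : Prog) (s : Store) (t : ℕ) (Q : Store → Prop) : Prop :=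
  ∃ s' k, Exec c s s' k [] ∧ k ≤ t ∧ Q s'

namespace Runs

variable {c d : Prog} {s : Store} {t t' : ℕ} {Q : Store → Prop}

theorem assign {x : ℕ} {e : Expr} (v : Data) (hv : e.eval s = v) (ht : e.cost s ≤ t)
    (h : ∀ s' : Store, s' x = v → (∀ y, y ≠ x → s' y = s y) → Q s') : Runs (.assign x e) s t Q :=
  ⟨_, _, .assign _ _ _, ht, h _ (by simp [hv]) fun _ hy => by simp [hy]⟩

theorem seq (h : Runs c s t fun s' => Runs d s' t' Q) : Runs (.seq c d) s (t + t') Q := by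
  obtain ⟨s', k, h1, h2, s'', l, h3, h4, h5⟩ := h
  exact ⟨s'', _, Exec.seq h1 h3, add_le_add h2 h4, h5⟩

theorem mono {R : Store → Prop} (h : Runs c s t R) (ht : t ≤ t') (hQ : ∀ s', R s' → Q s') :
    Runs c s t' Q :=
  let ⟨s', k, h1, h2, h3⟩ := h
  ⟨s', k, h1, h2.trans ht, hQ _ h3⟩

theorem ite {e : Expr} (h : e.cost s + t ≤ t') (h1 : e.eval s ≠ .nil → Runs c s t Q)
    (h2 : e.eval s = .nil → Runs d s t Q) : Runs (.ite e c d) s t' Q := by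
  by_cases he : e.eval s = .nil
  · obtain ⟨s', k, g1, g2, g3⟩ := h2 he
    exact ⟨s', _, .ite_false he g1, by omega, g3⟩
  · obtain ⟨s', k, g1, g2, g3⟩ := h1 he
    exact ⟨s', _, .ite_true he g1, by omega, g3⟩

theorem while_false {e : Expr} (he : e.eval s = .nil) (ht : e.cost s ≤ t) (h : Q s) :
    Runs (.while e c) s t Q :=
  ⟨s, _, .while_false he, ht, h⟩

theorem while_true {e : Expr} {r : ℕ} (he : e.eval s ≠ .nil) (hr : e.cost s + t + t' ≤ r)
    (h : Runs c s t fun s' => Runs (.while e c) s' t' Q) : Runs (.while e c) s r Q := by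
  obtain ⟨s', k, h1, h2, s'', l, h3, h4, h5⟩ := h
  exact ⟨s'', _, .while_true he h1 h3, by omega, h5⟩

end Runs

/-- `f` is computable in polynomial time by a program without output that uses only finitely many
variables, the contents of which (except for the argument, in variable `0`) do not matter. -/
def PolyTime {α β : Type} [Enc α] [Enc β] (f : α → β) : Prop :=
  ∃ (c : Prog) (n : ℕ) (T : α → ℕ), PolyBd T ∧ ∀ a, sz (f a) ≤ T a ∧ ∀ s : Store, s 0 = enc a →
    Runs c s (T a) fun s' => s' 0 = enc (f a) ∧ ∀ y > n, s' y = s y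

theorem Expr.size_eval_le_cost (e : Expr) (s : Store) : (e.eval s).size ≤ e.cost s := by
  cases e <;> simp [Expr.cost, Expr.eval, Data.size]

namespace PolyTime

variable {α β γ : Type} [Enc α] [Enc β] [Enc γ]

theorem bound {f : α → β} (hf : PolyTime f) : PolyBd fun a => sz (f a) :=
  let ⟨_, _, _, hT, h⟩ := hf
  hT.mono fun a => (h a).1

theorem cast {f : α → β} (hf : PolyTime f) {f' : α → γ} (h : ∀ a, enc (f' a) = enc (f a)) :
    PolyTime f' := by
  obtain ⟨c, n, T, hT, H⟩ := hf
  refine ⟨c, n, T, hT, fun a => ?_⟩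
  rw [sz, h]
  exact H a

theorem of_expr {f : α → β} (e : Expr) (T : α → ℕ) (hT : PolyBd T)
    (h : ∀ a s, s 0 = enc a → e.eval s = enc (f a) ∧ e.cost s ≤ T a) : PolyTime f := by
  refine ⟨.assign 0 e, 0, T, hT, fun a => ⟨?_, fun s hs => ?_⟩⟩
  · have := h a (fun _ => enc a) rfl
    rw [sz, ← this.1]
    exact (e.size_eval_le_cost _).trans this.2
  · exact .assign _ (h a s hs).1 (h a s hs).2 fun s' h1 h2 => ⟨h1, fun y hy => h2 y (by omega)⟩

theorem id : PolyTime fun a : α => a :=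
  of_expr (.var 0) sz .size fun a s hs => ⟨hs, by simp [Expr.cost, hs, sz]⟩

theorem comp {g : β → γ} {f : α → β} (hg : PolyTime g) (hf : PolyTime f) :
    PolyTime fun a => g (f a) := by
  have hb := hf.bound
  obtain ⟨c, n, S, hS, H⟩ := hf
  obtain ⟨d, m, T, hT, K⟩ := hg
  refine ⟨.seq c d, max n m, fun a => S a + T (f a), hS.add (hT.comp hb), fun a =>
    ⟨(K (f a)).1.trans (Nat.le_add_left _ _), fun s hs => ?_⟩⟩
  refine .seq (((H a).2 s hs).mono le_rfl fun s1 ⟨h1, h2⟩ => ?_)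
  refine ((K (f a)).2 s1 h1).mono le_rfl fun s2 ⟨h3, h4⟩ => ⟨h3, fun y hy => ?_⟩
  rw [h4 y (by omega), h2 y (by omega)]

theorem pair {f : α → β} {g : α → γ} (hf : PolyTime f) (hg : PolyTime g) :
    PolyTime fun a => (f a, g a) := by
  obtain ⟨c, n, S, hS, H⟩ := hf
  obtain ⟨d, m, T, hT, K⟩ := hg
  set N := max n m with hN
  refine ⟨.seq (.assign (N + 1) (.var 0)) (.seq c (.seq (.assign (N + 2) (.var 0))
    (.seq (.assign 0 (.var (N + 1))) (.seq d (.assign 0 (.cons (.var (N + 2)) (.var 0))))))), N + 2,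
    fun a => sz a + (S a + (S a + (sz a + (T a + (1 + 2 * S a + 2 * T a))))), ?_,
    fun a => ⟨?_, fun s hs => ?_⟩⟩
  · exact PolyBd.size.add (hS.add (hS.add (PolyBd.size.add (hT.add
      (((PolyBd.const 1).add ((PolyBd.const 2).mul hS)).add ((PolyBd.const 2).mul hT))))))
  · have := (H a).1
    have := (K a).1
    rw [sz_pair]
    beta_reduce
    omega
  refine .seq (.assign (enc a) hs (by simp [Expr.cost, hs, sz]) fun s1 h1 h1' => ?_)
  refine .seq (((H a).2 s1 (by rw [h1' 0 (by omega), hs])).mono le_rfl fun s2 ⟨h2, h2'⟩ => ?_)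
  refine .seq (.assign _ h2 (by simpa [Expr.cost, h2, sz] using (H a).1) fun s3 h3 h3' => ?_)
  refine .seq (.assign (enc a) ?_ (le_of_eq ?_) fun s4 h4 h4' => ?_)
  · simp only [Expr.eval]
    rw [h3' _ (by omega), h2' _ (by omega), h1]
  · simp only [Expr.cost]
    rw [h3' _ (by omega), h2' _ (by omega), h1, sz]
  refine .seq (((K a).2 s4 h4).mono le_rfl fun s5 ⟨h5, h5'⟩ => ?_)
  have e1 : s5 (N + 2) = enc (f a) := by rw [h5' _ (by omega), h4' _ (by omega), h3]
  refine .assign _ (by simp only [Expr.eval, e1, h5]; rfl) ?_ fun s6 h6 h6' => ⟨h6, fun y hy => ?_⟩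
  · have h1 := (H a).1
    have h2 := (K a).1
    simp only [Expr.cost, Expr.eval, e1, h5, Data.size]
    simp only [sz] at h1 h2
    omega
  · rw [h6' _ (by omega), h5' _ (by omega), h4' _ (by omega), h3' _ (by omega), h2' _ (by omega),
      h1' _ (by omega)]

theorem hd : PolyTime fun d : Data => d.hd := by
  refine of_expr (.hd (.var 0)) (fun a => sz a + sz a) (PolyBd.size.add .size) fun a s hs => ?_
  simp only [Expr.eval, Expr.cost, hs]
  refine ⟨rfl, ?_⟩
  cases a <;> simp [Data.hd, Data.size, sz, enc]
  omega

theorem tl : PolyTime fun d : Data => d.tl := by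
  refine of_expr (.tl (.var 0)) (fun a => sz a + sz a) (PolyBd.size.add .size) fun a s hs => ?_
  simp only [Expr.eval, Expr.cost, hs]
  refine ⟨rfl, ?_⟩
  cases a <;> simp [Data.tl, Data.size, sz, enc]

theorem encode : PolyTime fun a : α => enc a := PolyTime.id.cast fun _ => rfl

theorem fst {f : α → β × γ} (hf : PolyTime f) : PolyTime fun a => (f a).1 :=
  (hd.comp (encode.comp hf)).cast fun _ => rfl

theorem snd {f : α → β × γ} (hf : PolyTime f) : PolyTime fun a => (f a).2 :=
  (tl.comp (encode.comp hf)).cast fun _ => rfl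

theorem cons {f : α → β} {g : α → List β} (hf : PolyTime f) (hg : PolyTime g) :
    PolyTime fun a => f a :: g a :=
  (hf.pair hg).cast fun _ => rfl

theorem tail {f : α → List β} (hf : PolyTime f) : PolyTime fun a => (f a).tail :=
  (tl.comp (encode.comp hf)).cast fun a => by cases f a <;> rfl

theorem headD_of_nil {f : α → List β} (hf : PolyTime f) {b : β} (hb : enc b = .nil) :
    PolyTime fun a => (f a).headD b :=
  (hd.comp (encode.comp hf)).cast fun a => by
    cases f a
    · exact hb
    · rfl

theorem eq_data : PolyTime fun d : Data × Data => decide (d.1 = d.2) := by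
  refine of_expr (.eq (.hd (.var 0)) (.tl (.var 0))) (fun a => 4 * sz a + 3)
    (((PolyBd.const 4).mul .size).add (.const 3)) fun a s hs => ?_
  obtain ⟨a, b⟩ := a
  simp only [Expr.eval, Expr.cost, hs, enc_pair, Data.hd, Data.tl, sz, Data.size]
  refine ⟨rfl, ?_⟩
  have h : ∀ b : Bool, (Data.ofBool b).size ≤ 3 := sz_bool
  have := h (decide (enc a = enc b))
  omega

theorem eq {f g : α → β} [DecidableEq β] (h : (enc : β → Data).Injective) (hf : PolyTime f)
    (hg : PolyTime g) : PolyTime fun a => decide (f a = g a) :=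
  (eq_data.comp ((encode.comp hf).pair (encode.comp hg))).cast fun a => by
    simp [h.eq_iff]

theorem ite {b : α → Bool} {f g : α → β} (hb : PolyTime b) (hf : PolyTime f) (hg : PolyTime g) :
    PolyTime fun a => if b a then f a else g a := by
  obtain ⟨c, n, R, hR, H⟩ := encode.pair hb
  obtain ⟨d, m, S, hS, K⟩ := hf
  obtain ⟨e, l, T, hT, J⟩ := hg
  set N := max n (max m l) with hN
  refine ⟨.seq c (.seq (.assign (N + 1) (.tl (.var 0))) (.seq (.assign 0 (.hd (.var 0)))
    (.ite (.var (N + 1)) d e))), N + 1,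
    fun a => R a + (2 * R a + (2 * R a + (R a + (S a + T a)))), ?_, fun a => ⟨?_, fun s hs => ?_⟩⟩
  · exact hR.add (((PolyBd.const 2).mul hR).add (((PolyBd.const 2).mul hR).add (hR.add (hS.add hT))))
  · have := (K a).1
    have := (J a).1
    beta_reduce
    split_ifs <;> omega
  have hp : 1 + (enc a).size + (enc (b a)).size ≤ R a := (H a).1
  refine .seq (((H a).2 s hs).mono le_rfl fun s1 ⟨h1, h1'⟩ => ?_)
  refine .seq (.assign (enc (b a)) ?_ ?_ fun s2 h2 h2' => ?_)
  · simp [Expr.eval, h1, enc_pair, Data.tl]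
  · simp only [Expr.eval, Expr.cost, h1, enc_pair, Data.tl, Data.size]
    change 1 + (enc a).size + _ + _ ≤ _
    omega
  have e1 : s2 0 = .cons (enc a) (enc (b a)) := by rw [h2' _ (by omega), h1]; rfl
  refine .seq (.assign (enc a) ?_ ?_ fun s3 h3 h3' => ?_)
  · simp [Expr.eval, e1, Data.hd]
  · simp only [Expr.eval, Expr.cost, e1, Data.hd, Data.size]
    omega
  have e2 : s3 (N + 1) = enc (b a) := by rw [h3' _ (by omega), h2]
  refine .ite (add_le_add ?_ le_rfl) (fun h => ?_) fun h => ?_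
  · simp only [Expr.cost, e2]
    omega
  · have hb : b a = true := by
      rw [Expr.eval, e2] at h
      cases hb : b a
      · exact absurd (by rw [hb]; rfl) h
      · rfl
    refine ((K a).2 s3 h3).mono (Nat.le_add_right _ _) fun s4 ⟨h4, h4'⟩ => ⟨by simp [h4, hb], fun y hy => ?_⟩
    rw [h4' _ (by omega), h3' _ (by omega), h2' _ (by omega), h1' _ (by omega)]
  · have hb : b a = false := by
      rw [Expr.eval, e2] at h
      cases hb : b a
      · rfl
      · rw [hb] at h; cases h
    refine ((J a).2 s3 h3).mono (Nat.le_add_left _ _) fun s4 ⟨h4, h4'⟩ => ⟨by simp [h4, hb], fun y hy => ?_⟩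
    rw [h4' _ (by omega), h3' _ (by omega), h2' _ (by omega), h1' _ (by omega)]

/-- Iteration over a list, where an invariant `P` (on the rest of the list and the current value) bounds the sizes of the intermediate results. -/
theorem foldl {l : α → List β} {b : α → γ} {g : α → γ → β → γ} (hl : PolyTime l) (hb : PolyTime b)
    (hg : PolyTime fun x : α × γ × β => g x.1 x.2.1 x.2.2) (P : α → List β → γ → Prop)
    {B : α → ℕ} (hB : PolyBd B) (hPB : ∀ a l' c, P a l' c → sz c ≤ B a) (h0 : ∀ a, P a (l a) (b a))
    (hP : ∀ a c x l', x ∈ l a → P a (x :: l') c → P a l' (g a c x)) :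
    PolyTime fun a => (l a).foldl (g a) (b a) := by
  obtain ⟨c, n, R, hR, H⟩ := encode.pair (hl.pair hb)
  obtain ⟨d, m, S, ⟨p, hS⟩, K⟩ := hg
  set N := max n m with hN
  set body : Prog := .seq (.assign 0 (.cons (.var (N + 1)) (.cons (.var (N + 3)) (.hd (.var (N + 2))))))
    (.seq d (.seq (.assign (N + 3) (.var 0)) (.assign (N + 2) (.tl (.var (N + 2)))))) with hbody
  set M : α → ℕ := fun a => 5 * (2 + R a + B a) + (p.eval (2 + R a + B a) + (B a + 2 * R a)) with hM
  have hMB : PolyBd M := by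
    have h1 : PolyBd fun a => 2 + R a + B a := ((PolyBd.const 2).add hR).add hB
    exact ((PolyBd.const 5).mul h1).add ((h1.eval p).add (hB.add ((PolyBd.const 2).mul hR)))
  have hle : ∀ a, 2 + sz a + sz (l a) + sz (b a) ≤ R a := fun a => by
    have := (H a).1
    rw [sz_pair, sz_pair] at this
    simp only [sz] at *
    simp only [enc, id_eq] at *
    omega
  have hloop : ∀ a (l' : List β) (c : γ) (s : Store), (∀ x ∈ l', x ∈ l a) → sz l' ≤ sz (l a) → P a l' c →
      s (N + 1) = enc a → s (N + 2) = enc l' → s (N + 3) = enc c →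
      Runs (.while (.var (N + 2)) body) s ((l'.length + 1) * (R a + M a)) fun s' =>
        s' (N + 3) = enc (l'.foldl (g a) c) ∧ ∀ y > N + 3, s' y = s y := by
    intro a l'
    induction l' with
    | nil =>
      intro c s _ h1 _ _ h2 h3
      refine .while_false h2 ?_ ⟨h3, fun _ _ => rfl⟩
      have := hle a
      simp only [Expr.cost, h2]
      change sz ([] : List β) ≤ _
      simp only [List.length_nil, zero_add, one_mul]
      omega
    | cons x l' ih =>
      intro c s hl1 hl2 hc h1 h2 h3
      have hle := hle a
      have hcB := hPB a _ c hc
      have hc' := hP a c x l' (hl1 x (by simp)) hc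
      have hcB' := hPB a _ _ hc'
      have hl3 : sz x + sz l' < sz (l a) := by rw [sz_cons] at hl2; omega
      have hd1 := (K (a, c, x)).2
      have hS1 : S (a, c, x) ≤ p.eval (2 + R a + B a) :=
        (hS _).trans (eval_mono p (by rw [sz_pair, sz_pair]; omega))
      refine .while_true (t := M a) (t' := (l'.length + 1) * (R a + M a)) ?_ ?_ ?_
      · simp only [Expr.eval, h2]
        exact fun h => by cases h
      · have : (Expr.var (N + 2)).cost s ≤ R a := by
          simp only [Expr.cost, h2]
          change sz (x :: l') ≤ _
          omega
        rw [List.length_cons, Nat.succ_mul (l'.length + 1)]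
        omega
      simp only [sz] at hcB hcB' hl3 hle
      refine .seq (.assign (enc (a, c, x)) ?_ ?_ fun s1 e1 e1' => ?_)
      · simp [Expr.eval, h1, h2, h3, enc_pair, enc_cons, Data.hd]
      · simp only [Expr.cost, Expr.eval, h1, h2, h3, enc_cons, Data.hd, Data.size]
        omega
      refine .seq ((hd1 s1 e1).mono hS1 fun s2 ⟨e2, e2'⟩ => ?_)
      refine .seq (.assign _ e2 ?_ fun s3 e3 e3' => ?_)
      · simp only [Expr.cost, e2]
        exact hcB'
      have e4 : s3 (N + 2) = enc (x :: l') := by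
        rw [e3' _ (by omega), e2' _ (by omega), e1' _ (by omega), h2]
      refine .assign (enc l') ?_ ?_ fun s4 e5 e5' => ?_
      · simp [Expr.eval, e4, enc_cons, Data.tl]
      · simp only [Expr.cost, Expr.eval, e4, enc_cons, Data.tl, Data.size]
        omega
      refine (ih (g a c x) s4 (fun y hy => hl1 y (by simp [hy])) (by simp only [sz]; omega) hc' ?_ e5 ?_).mono
        le_rfl fun s5 ⟨e6, e6'⟩ => ⟨e6, fun y hy => ?_⟩
      · rw [e5' _ (by omega), e3' _ (by omega), e2' _ (by omega), e1' _ (by omega), h1]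
      · rw [e5' _ (by omega), e3]
      · rw [e6' _ (by omega), e5' _ (by omega), e3' _ (by omega), e2' _ (by omega), e1' _ (by omega)]
  have hfold : ∀ a, ∀ (l' : List β) (c : γ), (∀ x ∈ l', x ∈ l a) → P a l' c →
      P a [] (l'.foldl (g a) c) := by
    intro a l'
    induction l' with
    | nil => exact fun c _ h => h
    | cons x l' ih =>
      exact fun c h1 h2 => ih _ (fun y hy => h1 y (by simp [hy])) (hP a c x l' (h1 x (by simp)) h2)
  refine ⟨.seq c (.seq (.assign (N + 1) (.hd (.var 0))) (.seq (.assign (N + 2) (.hd (.tl (.var 0))))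
    (.seq (.assign (N + 3) (.tl (.tl (.var 0)))) (.seq (.while (.var (N + 2)) body)
    (.assign 0 (.var (N + 3))))))), N + 3,
    fun a => R a + (2 * R a + (3 * R a + (3 * R a + (R a * (R a + M a) + B a)))), ?_, fun a => ⟨?_,
      fun s hs => ?_⟩⟩
  · exact hR.add (((PolyBd.const 2).mul hR).add (((PolyBd.const 3).mul hR).add
      (((PolyBd.const 3).mul hR).add ((hR.mul (hR.add hMB)).add hB))))
  · have := hPB a _ _ (hfold a (l a) (b a) (fun _ h => h) (h0 a))
    beta_reduce
    omega
  have hle := hle a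
  have hlen := length_lt_sz (l a)
  have hlen2 : ((l a).length + 1) * (R a + M a) ≤ R a * (R a + M a) := Nat.mul_le_mul_right _ (by omega)
  have hp := hPB a _ _ (hfold a (l a) (b a) (fun _ h => h) (h0 a))
  simp only [sz] at hle hp
  refine .seq (((H a).2 s hs).mono le_rfl fun s1 ⟨h1, h1'⟩ => ?_)
  replace h1 : s1 0 = .cons (enc a) (.cons (enc (l a)) (enc (b a))) := h1
  refine .seq (.assign (enc a) ?_ ?_ fun s2 h2 h2' => ?_)
  · simp [Expr.eval, h1, Data.hd]
  · simp only [Expr.cost, Expr.eval, h1, Data.hd, Data.size]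
    omega
  have e2 : s2 0 = s1 0 := h2' _ (by omega)
  rw [h1] at e2
  refine .seq (.assign (enc (l a)) ?_ ?_ fun s3 h3 h3' => ?_)
  · simp [Expr.eval, e2, Data.hd, Data.tl]
  · simp only [Expr.cost, Expr.eval, e2, Data.hd, Data.tl, Data.size]
    omega
  have e3 : s3 0 = s2 0 := h3' _ (by omega)
  rw [e2] at e3
  refine .seq (.assign (enc (b a)) ?_ ?_ fun s4 h4 h4' => ?_)
  · simp [Expr.eval, e3, Data.tl]
  · simp only [Expr.cost, Expr.eval, e3, Data.tl, Data.size]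
    omega
  refine .seq ((hloop a (l a) (b a) s4 (fun _ h => h) le_rfl (h0 a) ?_ ?_ h4).mono hlen2
    fun s5 ⟨h5, h5'⟩ => ?_)
  · rw [h4' _ (by omega), h3' _ (by omega), h2]
  · rw [h4' _ (by omega), h3]
  refine .assign _ h5 ?_ fun s6 h6 h6' => ⟨h6, fun y hy => ?_⟩
  · simp only [Expr.cost, h5]
    exact hp
  · rw [h6' _ (by omega), h5' _ (by omega), h4' _ (by omega), h3' _ (by omega), h2' _ (by omega),
      h1' _ (by omega)]

end PolyTime

/-! ## Lists -/

/-- An expression for a constant. -/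
def Data.toExpr : Data → Expr
  | .nil => .nil
  | .cons a b => .cons a.toExpr b.toExpr

theorem Data.eval_toExpr (d : Data) (s : Store) : d.toExpr.eval s = d := by
  induction d <;> simp_all [Data.toExpr, Expr.eval]

theorem Data.cost_toExpr (d : Data) (s : Store) : d.toExpr.cost s = d.toExpr.cost fun _ => .nil := by
  induction d with
  | nil => rfl
  | cons a b iha ihb =>
    rw [Data.toExpr, Expr.cost, Expr.cost, iha, ihb, ← Data.toExpr, Data.eval_toExpr, Data.eval_toExpr]

namespace PolyTime

variable {α β γ : Type} [Enc α] [Enc β] [Enc γ]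

theorem const (b : β) : PolyTime fun _ : α => b :=
  of_expr (enc b).toExpr _ (.const _) fun _ s _ => ⟨Data.eval_toExpr _ _, (Data.cost_toExpr _ s).le⟩

theorem not {b : α → Bool} (hb : PolyTime b) : PolyTime fun a => !b a :=
  (hb.ite (const false) (const true)).cast fun a => by cases b a <;> rfl

theorem and {b c : α → Bool} (hb : PolyTime b) (hc : PolyTime c) : PolyTime fun a => b a && c a :=
  (hb.ite hc (const false)).cast fun a => by cases b a <;> rfl

theorem or {b c : α → Bool} (hb : PolyTime b) (hc : PolyTime c) : PolyTime fun a => b a || c a :=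
  (hb.ite (const true) hc).cast fun a => by cases b a <;> rfl

theorem isEmpty {l : α → List β} (hl : PolyTime l) : PolyTime fun a => (l a).isEmpty :=
  (eq_data.comp ((encode.comp hl).pair (const Data.nil))).cast fun a => by
    cases l a <;> rfl

/-- Iteration over a list, where each step adds at most a fixed polynomially bounded size. -/
theorem foldl_add {l : α → List β} {b : α → γ} {g : α → γ → β → γ} (hl : PolyTime l) (hb : PolyTime b)
    (hg : PolyTime fun x : α × γ × β => g x.1 x.2.1 x.2.2) {q : α → ℕ} (hq : PolyBd q)
    (h : ∀ a c, ∀ x ∈ l a, sz (g a c x) ≤ sz c + q a) :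
    PolyTime fun a => (l a).foldl (g a) (b a) := by
  refine foldl hl hb hg (fun a l' c => sz c + l'.length * q a ≤ sz (b a) + (l a).length * q a)
    (B := fun a => sz (b a) + sz (l a) * q a) (hb.bound.add (hl.bound.mul hq)) (fun a l' c hc => ?_)
    (fun a => le_rfl) fun a c x l' hx hc => ?_
  · exact (Nat.le_add_right _ _).trans (hc.trans
      (Nat.add_le_add_left (Nat.mul_le_mul_right _ (length_lt_sz _).le) _))
  · have := h a c x hx
    rw [List.length_cons, Nat.succ_mul] at hc
    omega

theorem any {l : α → List β} {p : α → β → Bool} (hl : PolyTime l)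
    (hp : PolyTime fun x : α × β => p x.1 x.2) : PolyTime fun a => (l a).any (p a) := by
  refine (foldl_add (g := fun a c x => c || p a x) hl (const false) ?_ (.const 3) ?_).cast
    (f' := fun a => (l a).any (p a)) fun a => ?_
  · exact (id.snd.fst).or (hp.comp (id.fst.pair id.snd.snd))
  · exact fun a c x _ => (sz_bool _).trans (Nat.le_add_left _ _)
  · suffices h : ∀ b, (l a).foldl (fun c x => c || p a x) b = (b || (l a).any (p a)) by
      rw [h, Bool.false_or]
    induction l a with
    | nil => simp
    | cons x l ih => intro b; rw [List.foldl_cons, ih, List.any_cons, Bool.or_assoc]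

theorem all {l : α → List β} {p : α → β → Bool} (hl : PolyTime l)
    (hp : PolyTime fun x : α × β => p x.1 x.2) : PolyTime fun a => (l a).all (p a) :=
  ((hl.any (p := fun a x => !p a x) hp.not).not).cast fun a => by
    rw [List.all_eq_not_any_not]

theorem reverse {l : α → List β} (hl : PolyTime l) : PolyTime fun a => (l a).reverse := by
  refine (foldl_add (g := fun _ c x => x :: c) hl (const []) ?_
    (q := fun a => 1 + sz (l a)) ((PolyBd.const 1).add hl.bound) ?_).cast
    (f' := fun a => (l a).reverse) fun a => ?_
  · exact (id.snd.snd).cons id.snd.fst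
  · intro a c x hx
    have := sz_le_of_mem hx
    rw [sz_cons]
    omega
  · rw [List.foldl_flip_cons_eq_append']
    simp

theorem append {l l' : α → List β} (hl : PolyTime l) (hl' : PolyTime l') :
    PolyTime fun a => l a ++ l' a := by
  refine (foldl_add (g := fun _ c x => x :: c) hl.reverse hl' ?_
    (q := fun a => 1 + sz (l a)) ((PolyBd.const 1).add hl.bound) ?_).cast
    (f' := fun a => l a ++ l' a) fun a => ?_
  · exact (id.snd.snd).cons id.snd.fst
  · intro a c x hx
    have := sz_le_of_mem (List.mem_reverse.1 hx)
    rw [sz_cons]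
    omega
  · rw [List.foldl_flip_cons_eq_append']
    simp

theorem filter_map {l : α → List β} {p : α → β → Bool} {f : α → β → γ} (hl : PolyTime l)
    (hp : PolyTime fun x : α × β => p x.1 x.2) (hf : PolyTime fun x : α × β => f x.1 x.2) :
    PolyTime fun a => ((l a).filter (p a)).map (f a) := by
  obtain ⟨r, hr⟩ := hf.bound
  refine (foldl_add (g := fun a c x => if p a x then f a x :: c else c) hl (const []) ?_
    (q := fun a => 1 + r.eval (1 + sz a + sz (l a)))
    ((PolyBd.const 1).add ((((PolyBd.const 1).add .size).add hl.bound).eval r)) ?_).reverse.cast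
    (f' := fun a => ((l a).filter (p a)).map (f a)) fun a => ?_
  · exact (hp.comp (id.fst.pair id.snd.snd)).ite ((hf.comp (id.fst.pair id.snd.snd)).cons id.snd.fst)
      id.snd.fst
  · intro a c x hx
    have h1 := sz_le_of_mem hx
    have h2 : sz (f a x) ≤ _ := hr (a, x)
    have h3 := h2.trans (eval_mono r (n := 1 + sz a + sz (l a)) (by rw [sz_pair]; omega))
    split_ifs
    · rw [sz_cons]
      omega
    · omega
  · suffices h : ∀ c, ((l a).foldl (fun c x => if p a x then f a x :: c else c) c).reverse =
        c.reverse ++ ((l a).filter (p a)).map (f a) by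
      rw [h]; rfl
    induction l a with
    | nil => simp
    | cons x l ih =>
      intro c
      rw [List.foldl_cons, ih, List.filter_cons]
      split_ifs <;> simp

theorem map {l : α → List β} {f : α → β → γ} (hl : PolyTime l)
    (hf : PolyTime fun x : α × β => f x.1 x.2) : PolyTime fun a => (l a).map (f a) :=
  (filter_map (p := fun _ _ => true) hl (const true) hf).cast fun a => by simp

theorem filter {l : α → List β} {p : α → β → Bool} (hl : PolyTime l)
    (hp : PolyTime fun x : α × β => p x.1 x.2) : PolyTime fun a => (l a).filter (p a) :=
  (filter_map (f := fun _ x => x) hl hp id.snd).cast fun a => by simp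

theorem flatten {l : α → List (List β)} (hl : PolyTime l) : PolyTime fun a => (l a).flatten := by
  refine (foldl_add (g := fun _ c x => c ++ x) hl (const []) ?_ hl.bound ?_).cast
    (f' := fun a => (l a).flatten) fun a => ?_
  · exact (id.snd.fst).append id.snd.snd
  · intro a c x hx
    have h1 := sz_le_of_mem hx
    have h2 := sz_append c x
    omega
  · suffices h : ∀ c, (l a).foldl (fun c x => c ++ x) c = c ++ (l a).flatten by
      rw [h]; rfl
    induction l a with
    | nil => simp
    | cons x l ih => intro c; rw [List.foldl_cons, ih]; simp

end PolyTime

/-! ## Programs as subroutines -/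

/-- A bound for the variables of an expression. -/
def Expr.maxVar : Expr → ℕ
  | .var x => x
  | .nil => 0
  | .cons e f => max e.maxVar f.maxVar
  | .hd e => e.maxVar
  | .tl e => e.maxVar
  | .eq e f => max e.maxVar f.maxVar

/-- A bound for the variables of a program. -/
def Prog.maxVar : Prog → ℕ
  | .assign x e => max x e.maxVar
  | .emit e => e.maxVar
  | .seq c d => max c.maxVar d.maxVar
  | .ite e c d => max e.maxVar (max c.maxVar d.maxVar)
  | .while e c => max e.maxVar c.maxVar

/-- The program without its output. -/
def Prog.silent : Prog → Prog
  | .assign x e => .assign x e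
  | .emit e => .while .nil (.emit e)
  | .seq c d => .seq c.silent d.silent
  | .ite e c d => .ite e c.silent d.silent
  | .while e c => .while e c.silent

/-- Set the variables `1, …, n` to `nil`. -/
def Prog.clear : ℕ → Prog
  | 0 => .while .nil (.emit .nil)
  | n + 1 => .seq (.clear n) (.assign (n + 1) .nil)

theorem Expr.eval_congr {e : Expr} {s t : Store} (h : ∀ y ≤ e.maxVar, t y = s y) :
    e.eval t = e.eval s := by
  induction e with
  | var x => exact h x le_rfl
  | nil => rfl
  | hd e ih => rw [eval, eval, ih h]
  | tl e ih => rw [eval, eval, ih h]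
  | cons e f ihe ihf | eq e f ihe ihf =>
    simp only [maxVar, le_max_iff] at h
    rw [eval, eval, ihe fun y hy => h y (.inl hy), ihf fun y hy => h y (.inr hy)]

theorem Expr.cost_congr {e : Expr} {s t : Store} (h : ∀ y ≤ e.maxVar, t y = s y) :
    e.cost t = e.cost s := by
  induction e with
  | var x => rw [cost, cost, h x le_rfl]
  | nil => rfl
  | hd e ih => rw [cost, cost, ih h, eval_congr h]
  | tl e ih => rw [cost, cost, ih h, eval_congr h]
  | cons e f ihe ihf | eq e f ihe ihf =>
    rw [cost, cost, eval_congr h]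
    simp only [maxVar, le_max_iff] at h
    rw [ihe fun y hy => h y (.inl hy), ihf fun y hy => h y (.inr hy)]

theorem Expr.cost_pos (e : Expr) (s : Store) : 0 < e.cost s :=
  (Data.size_pos _).trans_le (e.size_eval_le_cost s)

theorem Runs.silent {c : Prog} {s s' : Store} {k : ℕ} {L : Output} (h : Exec c s s' k L) :
    ∀ n ≥ c.maxVar, ∀ t : Store, (∀ y ≤ n, t y = s y) →
      Runs c.silent t k fun t' => (∀ y ≤ n, t' y = s' y) ∧ ∀ y > n, t' y = t y := by
  induction h with
  | assign x e s =>
    intro n hn t ht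
    rw [Prog.maxVar, ge_iff_le, max_le_iff] at hn
    have he : ∀ y ≤ e.maxVar, t y = s y := fun y hy => ht y (hy.trans hn.2)
    refine .assign _ (Expr.eval_congr he) (Expr.cost_congr he).le fun t' h1 h2 =>
      ⟨fun y hy => ?_, fun y hy => h2 y (by omega)⟩
    rcases eq_or_ne y x with rfl | hx
    · rw [h1, Function.update_self]
    · rw [h2 y hx, Function.update_of_ne hx, ht y hy]
  | emit e s =>
    exact fun n hn t ht => .while_false rfl (e.cost_pos s) ⟨ht, fun _ _ => rfl⟩
  | seq _ _ ihc ihd =>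
    intro n hn t ht
    rw [Prog.maxVar, ge_iff_le, max_le_iff] at hn
    refine .seq ((ihc n hn.1 t ht).mono le_rfl fun t1 ⟨h1, h1'⟩ => ?_)
    exact (ihd n hn.2 t1 h1).mono le_rfl fun t2 ⟨h2, h2'⟩ =>
      ⟨h2, fun y hy => (h2' y hy).trans (h1' y hy)⟩
  | @ite_true e c d s s' k L he _ ih =>
    intro n hn t ht
    rw [Prog.maxVar, ge_iff_le, max_le_iff, max_le_iff] at hn
    have h : ∀ y ≤ e.maxVar, t y = s y := fun y hy => ht y (hy.trans hn.1)
    refine .ite (Nat.add_le_add_right (Expr.cost_congr h).le _) (fun _ => ih n hn.2.1 t ht) fun h' => ?_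
    exact absurd ((Expr.eval_congr h).symm.trans h') he
  | @ite_false e c d s s' k L he _ ih =>
    intro n hn t ht
    rw [Prog.maxVar, ge_iff_le, max_le_iff, max_le_iff] at hn
    have h : ∀ y ≤ e.maxVar, t y = s y := fun y hy => ht y (hy.trans hn.1)
    refine .ite (Nat.add_le_add_right (Expr.cost_congr h).le _) (fun h' => ?_) fun _ => ih n hn.2.2 t ht
    exact absurd ((Expr.eval_congr h).trans he) h'
  | @while_false e c s he =>
    intro n hn t ht
    rw [Prog.maxVar, ge_iff_le, max_le_iff] at hn
    have h : ∀ y ≤ e.maxVar, t y = s y := fun y hy => ht y (hy.trans hn.1)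
    exact .while_false ((Expr.eval_congr h).trans he) (Expr.cost_congr h).le ⟨ht, fun _ _ => rfl⟩
  | @while_true e c s s' s'' k l L M he _ _ ihc ihw =>
    intro n hn t ht
    have hn' := hn
    rw [Prog.maxVar, ge_iff_le, max_le_iff] at hn
    have h : ∀ y ≤ e.maxVar, t y = s y := fun y hy => ht y (hy.trans hn.1)
    refine .while_true (fun h' => he ((Expr.eval_congr h).symm.trans h'))
      (by rw [Expr.cost_congr h]) ((ihc n hn.2 t ht).mono le_rfl fun t1 ⟨h1, h1'⟩ => ?_)
    exact (ihw n hn' t1 h1).mono le_rfl fun t2 ⟨h2, h2'⟩ =>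
      ⟨h2, fun y hy => (h2' y hy).trans (h1' y hy)⟩

theorem Runs.clear (s : Store) (n : ℕ) :
    Runs (.clear n) s (n + 1) fun s' => (∀ y, 0 < y → y ≤ n → s' y = .nil) ∧
      ∀ y, y = 0 ∨ n < y → s' y = s y := by
  induction n with
  | zero => exact .while_false rfl le_rfl ⟨fun y h h' => by omega, fun _ _ => rfl⟩
  | succ n ih =>
    refine .seq (ih.mono le_rfl fun s1 ⟨h1, h1'⟩ => ?_)
    refine .assign .nil rfl le_rfl fun s2 h2 h2' => ⟨fun y hy hy' => ?_, fun y hy => ?_⟩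
    · rcases eq_or_ne y (n + 1) with rfl | h
      · exact h2
      · rw [h2' y h, h1 y hy (by omega)]
    · rw [h2' y (by omega), h1' y (by omega)]

theorem Exec.size_le {c : Prog} {s s' : Store} {k : ℕ} {L : Output} (h : Exec c s s' k L) (x : ℕ) :
    (s' x).size ≤ (s x).size + k := by
  induction h with
  | assign y e s =>
    rcases eq_or_ne x y with rfl | h
    · rw [Function.update_self]
      exact (e.size_eval_le_cost s).trans (Nat.le_add_left _ _)
    · rw [Function.update_of_ne h]
      exact Nat.le_add_right _ _
  | emit | while_false => exact Nat.le_add_right _ _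
  | seq | ite_true | ite_false | while_true => omega

theorem PolyTime.of_polyTimeComputableOn {α β : Type} [Enc α] [Enc β] {D : α → Prop} {f : α → β}
    (h : PolyTimeComputableOn D enc enc f) : PolyTime fun a : {a // D a} => f a.1 := by
  obtain ⟨c, p, h⟩ := h
  refine ⟨.seq (.clear c.maxVar) c.silent, c.maxVar, fun a => c.maxVar + 1 + (sz a + p.eval (sz a)),
    (PolyBd.const _).add (PolyBd.size.add (PolyBd.size.eval p)), fun a => ?_⟩
  obtain ⟨s', k, L, h1, h2, h3⟩ := h a.1 a.2
  constructor
  · have := h1.size_le 0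
    rw [h2, initStore, Function.update_self] at this
    exact (this.trans (Nat.add_le_add_left h3 _)).trans (Nat.le_add_left _ _)
  · intro s hs
    refine .seq ((Runs.clear s _).mono le_rfl fun s1 ⟨g1, g2⟩ => ?_)
    refine (Runs.silent h1 _ le_rfl s1 fun y hy => ?_).mono (h3.trans (Nat.le_add_left _ _))
      fun s2 ⟨g3, g4⟩ => ⟨(g3 0 (Nat.zero_le _)).trans h2, fun y hy => ?_⟩
    · rcases eq_or_ne y 0 with rfl | hy0
      · rw [initStore, Function.update_self, g2 0 (.inl rfl), hs]
        rfl
      · rw [initStore, Function.update_of_ne hy0, g1 y (by omega) hy]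
    · rw [g4 y hy, g2 y (.inr hy)]

/-! ## Local consistency -/

/-- A row of a table: a list of pairs of a variable and its value. -/
abbrev Row := List (ℕ × ℕ)

/-- Two rows agree on their common variables. -/
def compat (r r' : Row) : Bool :=
  r.all fun x => r'.all fun y => !decide (x.1 = y.1) || decide (x.2 = y.2)

/-- The row `r` is functional, and every table has a row that agrees with it. -/
def supported (T : List (List Row)) (r : Row) : Bool :=
  compat r r && T.all fun R => R.any fun r' => compat r r'

/-- Delete all the rows that are not supported. -/
def prune (T : List (List Row)) : List (List Row) := T.map fun R => R.filter (supported T)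

/-- The largest pairwise consistent family of subtables. -/
def pruneAll (T : List (List Row)) : List (List Row) := T.flatten.foldl (fun U _ => prune U) T

/-- The largest pairwise consistent family of subtables has no empty table. -/
def consistent (T : List (List Row)) : Bool := (pruneAll T).all fun R => !R.isEmpty

theorem compat_iff {r r' : Row} :
    compat r r' = true ↔ ∀ x ∈ r, ∀ y ∈ r', x.1 = y.1 → x.2 = y.2 := by
  simp [compat, imp_iff_not_or]

theorem compat_symm {r r' : Row} (h : compat r r' = true) : compat r' r = true :=
  compat_iff.2 fun x hx y hy e => (compat_iff.1 h y hy x hx e.symm).symm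

theorem supported_iff {T : List (List Row)} {r : Row} :
    supported T r = true ↔ compat r r = true ∧ ∀ R ∈ T, ∃ r' ∈ R, compat r r' = true := by
  simp [supported]

theorem prune_eq_or_lt (T : List (List Row)) :
    prune T = T ∨ (prune T).flatten.length < T.flatten.length := by
  by_cases h : ∀ r ∈ T.flatten, supported T r = true
  · left
    conv_rhs => rw [← List.map_id T]
    refine List.map_congr_left fun R hR => ?_
    exact List.filter_eq_self.2 fun r hr => h r (List.mem_flatten.2 ⟨R, hR, hr⟩)
  · right
    push Not at h
    obtain ⟨r, hr, h⟩ := h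
    rw [prune, ← List.filter_flatten]
    exact List.length_filter_lt_length_iff_exists.2 ⟨r, hr, h⟩

theorem prune_iterate (n : ℕ) (T : List (List Row)) (h : T.flatten.length ≤ n) :
    prune (prune^[n] T) = prune^[n] T := by
  induction n generalizing T with
  | zero =>
    rcases prune_eq_or_lt T with h' | h'
    · exact h'
    · omega
  | succ n ih =>
    rw [Function.iterate_succ_apply]
    rcases prune_eq_or_lt T with h' | h'
    · have := Function.iterate_fixed h' n
      rw [h', this, h']
    · exact ih _ (by omega)

theorem pruneAll_eq (T : List (List Row)) : pruneAll T = prune^[T.flatten.length] T :=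
  List.foldl_const _ _ _

theorem prune_pruneAll (T : List (List Row)) : prune (pruneAll T) = pruneAll T := by
  rw [pruneAll_eq]
  exact prune_iterate _ _ le_rfl

theorem iterate_prune_map {ι : Type} (S : List ι) (tab : ι → List Row) (n : ℕ) :
    ∃ tab' : ι → List Row, prune^[n] (S.map tab) = S.map tab' ∧ ∀ i, tab' i ⊆ tab i := by
  induction n with
  | zero => exact ⟨tab, rfl, fun _ => List.Subset.refl _⟩
  | succ n ih =>
    obtain ⟨tab', h1, h2⟩ := ih
    rw [Function.iterate_succ_apply', h1]
    exact ⟨fun i => (tab' i).filter (supported (S.map tab')), by simp [prune], fun i =>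
      List.Subset.trans (List.filter_subset_self _) (h2 i)⟩

/-- If each table has a row given by `h`, then this remains so. -/
theorem consistent_of_forall {T : List (List Row)} (h : ℕ → ℕ)
    (hT : ∀ R ∈ T, ∃ r ∈ R, ∀ x ∈ r, x.2 = h x.1) : consistent T = true := by
  have key : ∀ n, ∀ R ∈ prune^[n] T, ∃ r ∈ R, ∀ x ∈ r, x.2 = h x.1 := by
    intro n
    induction n with
    | zero => exact hT
    | succ n ih =>
      rw [Function.iterate_succ_apply']
      intro R hR
      obtain ⟨R', hR', rfl⟩ := List.mem_map.1 hR
      obtain ⟨r, hr, hrh⟩ := ih R' hR'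
      have hc : ∀ r' : Row, (∀ x ∈ r', x.2 = h x.1) → compat r r' = true := fun r' hr' =>
        compat_iff.2 fun x hx y hy e => by rw [hrh x hx, hr' y hy, e]
      refine ⟨r, List.mem_filter.2 ⟨hr, supported_iff.2 ⟨hc r hrh, fun R' hR' => ?_⟩⟩, hrh⟩
      obtain ⟨r', h1, h2⟩ := ih R' hR'
      exact ⟨r', h1, hc r' h2⟩
  rw [consistent, pruneAll_eq, List.all_eq_true]
  intro R hR
  obtain ⟨r, hr, -⟩ := key _ R hR
  cases R
  · simp at hr
  · rfl

theorem exists_of_consistent {ι : Type} {S : List ι} {tab : ι → List Row}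
    (h : consistent (S.map tab) = true) : ∃ tab' : ι → List Row, (∀ i, tab' i ⊆ tab i) ∧
      (∀ i ∈ S, ∃ r, r ∈ tab' i) ∧ (∀ i ∈ S, ∀ r ∈ tab' i, compat r r = true) ∧
      ∀ i ∈ S, ∀ j ∈ S, ∀ r ∈ tab' i, ∃ r' ∈ tab' j, compat r r' = true := by
  obtain ⟨tab', h1, h2⟩ := iterate_prune_map S tab (S.map tab).flatten.length
  rw [← pruneAll_eq] at h1
  have h3 := prune_pruneAll (S.map tab)
  rw [consistent, h1, List.all_eq_true] at h
  rw [h1, prune, List.map_map] at h3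
  have h4 : ∀ i ∈ S, ∀ r ∈ tab' i, supported (S.map tab') r = true := fun i hi =>
    List.filter_eq_self.1 (List.map_inj_left.1 h3 i hi)
  refine ⟨tab', h2, fun i hi => ?_, fun i hi r hr => (supported_iff.1 (h4 i hi r hr)).1,
    fun i hi j hj r hr => (supported_iff.1 (h4 i hi r hr)).2 _ (List.mem_map_of_mem hj)⟩
  have := h _ (List.mem_map_of_mem hi)
  rw [Bool.not_eq_true', List.isEmpty_eq_false_iff] at this
  exact List.exists_mem_of_ne_nil _ this

/-! ## Pairwise consistency on trees -/

/-- Propagate a value along a walk, from its end to its start. -/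
def walkFold {V ρ : Type} {G : SimpleGraph V} (r : ρ) (next : ρ → V → ρ) : ∀ {v w : V}, G.Walk v w → ρ
  | _, _, .nil => r
  | v, _, .cons _ p => next (walkFold r next p) v

theorem exists_adj_compatible {V ρ : Type} {G : SimpleGraph V} (hG : G.Preconnected)
    (hG' : G.IsAcyclic) (tab : V → ρ → Prop) (C : ρ → ρ → Prop) (hC : ∀ r r', C r r' → C r' r)
    (hne : ∀ v, ∃ r, tab v r) (hext : ∀ v w r, tab v r → ∃ r', tab w r' ∧ C r r') :
    ∃ g : V → ρ, (∀ v, tab v (g v)) ∧ ∀ v w, G.Adj v w → C (g v) (g w) := by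
  classical
  rcases isEmpty_or_nonempty V with hV | ⟨⟨root⟩⟩
  · exact ⟨fun v => isEmptyElim v, fun v => isEmptyElim v, fun v => isEmptyElim v⟩
  obtain ⟨r0, hr0⟩ := hne root
  have hnext : ∀ r w, ∃ r', (∃ v, tab v r) → tab w r' ∧ C r r' := fun r w => by
    by_cases h : ∃ v, tab v r
    · obtain ⟨v, hv⟩ := h
      obtain ⟨r', hr'⟩ := hext v w r hv
      exact ⟨r', fun _ => hr'⟩
    · exact ⟨r, fun h' => absurd h' h⟩
  choose next hnext using hnext
  have hpath : ∀ v, ∃ p : G.Walk v root, p.IsPath := fun v => by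
    obtain ⟨p⟩ := hG v root
    exact ⟨p.bypass, p.bypass_isPath⟩
  choose P hP using hpath
  have huniq : ∀ {v w : V} (p q : G.Walk v w), p.IsPath → q.IsPath → p = q := fun p q hp hq =>
    congrArg Subtype.val ((hG'.subsingleton_path _ _).elim ⟨p, hp⟩ ⟨q, hq⟩)
  have htab : ∀ {v w : V} (p : G.Walk v w), w = root → tab v (walkFold r0 next p) := by
    intro v w p
    induction p with
    | nil => rintro rfl; exact hr0
    | cons _ _ ih => exact fun h => (hnext _ _ ⟨_, ih h⟩).1
  have hstep : ∀ v w, G.Adj v w → w ∈ (P v).support → C (walkFold r0 next (P w)) (walkFold r0 next (P v)) := by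
    intro v w hvw hw
    have h1 : (P v).dropUntil w hw = P w := huniq _ _ ((hP v).dropUntil hw) (hP w)
    have h2 : (P v).takeUntil w hw = .cons hvw .nil := huniq _ _ ((hP v).takeUntil hw) (by
      simp [SimpleGraph.Walk.cons_isPath_iff, hvw.ne])
    have h3 := (P v).take_spec hw
    rw [h1, h2] at h3
    rw [← h3]
    exact (hnext _ _ ⟨_, htab (P w) rfl⟩).2
  refine ⟨fun v => walkFold r0 next (P v), fun v => htab _ rfl, fun v w hvw => ?_⟩
  by_cases hw : w ∈ (P v).support
  · exact hC _ _ (hstep v w hvw hw)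
  · refine hstep w v hvw.symm ?_
    have : P w = .cons hvw.symm (P v) := huniq _ _ (hP w) ((SimpleGraph.Walk.cons_isPath_iff _ _).2
      ⟨hP v, hw⟩)
    rw [this]
    simp

/-- A pairwise consistent family of rows on a join tree comes from one assignment. -/
theorem exists_assignment {H : Hypergraph} (hH : H.Acyclic) (tab : {e // e ∈ H.edges} → Row → Prop)
    (hdom : ∀ e r, tab e r → ∀ x ∈ e.1, ∃ a, (x, a) ∈ r)
    (hself : ∀ e r, tab e r → compat r r = true) (hne : ∀ e, ∃ r, tab e r)
    (hext : ∀ e f r, tab e r → ∃ r', tab f r' ∧ compat r r' = true) :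
    ∃ h : ℕ → ℕ, ∀ e, ∃ r, tab e r ∧ ∀ x ∈ r, x.1 ∈ e.1 → h x.1 = x.2 := by
  classical
  obtain ⟨T, hT1, hT2, hT3⟩ := hH
  obtain ⟨g, hg1, hg2⟩ := exists_adj_compatible hT1 hT2 tab (fun r r' => compat r r' = true)
    (fun _ _ => compat_symm) hne hext
  have hwalk : ∀ {e f} (p : T.Walk e f) (X : ℕ), (∀ k ∈ p.support, X ∈ k.1) → ∀ a b,
      (X, a) ∈ g e → (X, b) ∈ g f → a = b := by
    intro e f p X
    induction p with
    | nil => exact fun _ a b ha hb => compat_iff.1 (hself _ _ (hg1 _)) _ ha _ hb rfl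
    | cons hadj p ih =>
      intro hX a b ha hb
      rw [SimpleGraph.Walk.support_cons] at hX
      have hX' : ∀ k ∈ p.support, X ∈ k.1 := fun k hk => hX k (List.mem_cons_of_mem _ hk)
      obtain ⟨c, hc⟩ := hdom _ _ (hg1 _) X (hX' _ p.start_mem_support)
      exact (compat_iff.1 (hg2 _ _ hadj) _ ha _ hc rfl).trans (ih hX' c b hc hb)
  have hval : ∀ X, ∃ a, ∀ e, X ∈ e.1 → ∀ b, (X, b) ∈ g e → a = b := by
    intro X
    by_cases h : ∃ e : {e // e ∈ H.edges}, X ∈ e.1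
    · obtain ⟨e, he⟩ := h
      obtain ⟨a, ha⟩ := hdom e _ (hg1 e) X he
      refine ⟨a, fun f hf b hb => ?_⟩
      obtain ⟨p⟩ := hT1 e f
      exact hwalk p.bypass X (hT3 e f X he hf _ p.bypass_isPath) a b ha hb
    · push Not at h
      exact ⟨0, fun e he => absurd he (h e)⟩
  choose h hh using hval
  exact ⟨h, fun e => ⟨g e, hg1 e, fun x hx hxe => hh x.1 e hxe x.2 hx⟩⟩

/-! ## Deciding the existence of homomorphisms -/

/-- The variables of a view. -/
def viewVars (V : Str) (R : Symbol) : List ℕ := (V.rel R).sort.headD []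

/-- The table of a view. -/
def table (V W : Str) (R : Symbol) : List Row := (W.rel R).sort.map fun u => (viewVars V R).zip u

/-- The tables of all views. -/
def tables (V W : Str) : List (List Row) := V.vocab.sort.map (table V W)

/-- The test for the existence of a homomorphism. -/
def homTest (DM : DecompositionMethod) (A B : Str) : Bool :=
  (A.univ.sort.isEmpty || !B.univ.sort.isEmpty) && consistent (tables (DM.lDM A) (DM.rDM A B))

theorem viewVars_eq {V : Str} {R : Symbol} {w : List ℕ} (h : V.rel R = {w}) : viewVars V R = w := by
  rw [viewVars, h, Finset.sort_singleton]
  rfl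

theorem sort_isEmpty {α : Type} [LinearOrder α] (s : Finset α) : s.sort.isEmpty = true ↔ s = ∅ := by
  rw [List.isEmpty_iff, ← List.length_eq_zero_iff, Finset.length_sort, Finset.card_eq_zero]

theorem map_eq_of_zip {h : ℕ → ℕ} : ∀ {w u : List ℕ}, w.length = u.length →
    (∀ x ∈ w.zip u, h x.1 = x.2) → w.map h = u
  | [], [], _, _ => rfl
  | a :: w, b :: u, hl, hx => by
    rw [List.map_cons, hx (a, b) (by simp), map_eq_of_zip (w := w) (u := u) (by simpa using hl)]
    intro x h
    exact hx x (by simp [h])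

theorem homTest_of_isHom (DM : DecompositionMethod) {A B : Str} (hAB : B.vocab = A.vocab) {h : ℕ → ℕ}
    (hh : IsHom A B h) : homTest DM A B = true := by
  rw [homTest, Bool.and_eq_true, Bool.or_eq_true, Bool.not_eq_true', ← Bool.not_eq_true, sort_isEmpty,
    sort_isEmpty]
  constructor
  · rcases A.univ.eq_empty_or_nonempty with h1 | ⟨x, hx⟩
    · exact .inl h1
    · exact .inr (Finset.ne_empty_of_mem (hh.1 x hx))
  · refine consistent_of_forall h fun R hR => ?_
    obtain ⟨S, hS, rfl⟩ := List.mem_map.1 hR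
    rw [Finset.mem_sort] at hS
    obtain ⟨w, hw⟩ := (DM.isViewStructure A).single S hS
    have := (DM.isLegal A B hAB).projection S hS w (by simp [hw]) h hh
    refine ⟨w.zip (w.map h), List.mem_map.2 ⟨_, (Finset.mem_sort _).2 this, by rw [viewVars_eq hw]⟩, ?_⟩
    intro x hx
    have : w.zip (w.map h) = w.map fun a => (a, h a) := by
      simpa using List.zip_map' (f := id) (g := h) (l := w)
    rw [this, List.mem_map] at hx
    obtain ⟨a, -, rfl⟩ := hx
    rfl

theorem exists_isHom_of_homTest (DM : DecompositionMethod) {A B : Str} (hAB : B.vocab = A.vocab)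
    {O : Finset ℕ} (hO : TPCovered DM A O) (ht : homTest DM A B = true) : ∃ h, IsHom A B h := by
  classical
  rw [homTest, Bool.and_eq_true, Bool.or_eq_true, Bool.not_eq_true', ← Bool.not_eq_true, sort_isEmpty,
    sort_isEmpty] at ht
  obtain ⟨hne, ht⟩ := ht
  obtain ⟨A', ⟨⟨hv, hu, hrel⟩, ⟨f, hf⟩, -⟩, H, hH, hA'H, hHV⟩ := hO
  set V := DM.lDM A
  set W := DM.rDM A B
  have hview := DM.isViewStructure A
  have hlegal := DM.isLegal A B hAB
  obtain ⟨tab, htab, hne', hself, hext⟩ := exists_of_consistent ht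
  have hcover : ∀ e : {e // e ∈ H.edges}, ∃ S ∈ V.vocab, e.1 ⊆ (viewVars V S).toFinset := by
    intro e
    obtain ⟨d, hd, hed⟩ := hHV e.1 e.2
    obtain ⟨S, hS, hd⟩ := Finset.mem_biUnion.1 hd
    obtain ⟨w, hw⟩ := hview.single S hS
    rw [hw, Finset.image_singleton, Finset.mem_singleton] at hd
    exact ⟨S, hS, by rwa [viewVars_eq hw, ← hd]⟩
  choose F hF1 hF2 using hcover
  have hlen : ∀ S ∈ V.vocab, ∀ u ∈ W.rel S, (viewVars V S).length = u.length := by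
    intro S hS u hu
    obtain ⟨w, hw⟩ := hview.single S hS
    rw [viewVars_eq hw, V.length_eq S w (by rw [hw]; exact Finset.mem_singleton_self w), W.length_eq S u hu]
  have hrow : ∀ S, ∀ r ∈ tab S, ∃ u ∈ W.rel S, r = (viewVars V S).zip u := by
    intro S r hr
    obtain ⟨u, hu, rfl⟩ := List.mem_map.1 (htab S hr)
    exact ⟨u, (Finset.mem_sort _).1 hu, rfl⟩
  have hdom : ∀ S ∈ V.vocab, ∀ r ∈ tab S, ∀ x ∈ viewVars V S, ∃ a, (x, a) ∈ r := by
    intro S hS r hr x hx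
    obtain ⟨u, hu, rfl⟩ := hrow S r hr
    rw [← List.map_fst_zip (hlen S hS u hu).le, List.mem_map] at hx
    obtain ⟨⟨y, a⟩, hy, rfl⟩ := hx
    exact ⟨a, hy⟩
  obtain ⟨g, hg⟩ := exists_assignment hH (fun e r => r ∈ tab (F e))
    (fun e r hr x hx => hdom _ (hF1 e) r hr x (List.mem_toFinset.1 (hF2 e hx)))
    (fun e r hr => hself _ ((Finset.mem_sort _).2 (hF1 e)) r hr)
    (fun e => hne' _ ((Finset.mem_sort _).2 (hF1 e)))
    (fun e e' r hr => hext _ ((Finset.mem_sort _).2 (hF1 e)) _ ((Finset.mem_sort _).2 (hF1 e')) r hr)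
  have htuple : ∀ R ∈ A.vocab, ∀ t ∈ A'.rel (.inl R), t.map g ∈ B.rel R := by
    intro R hR t ht'
    have hR' : (Sum.inl R : Symbol ⊕ MarkSymbol) ∈ (A.disjUnion (marks O)).vocab :=
      Finset.inl_mem_disjSum.2 hR
    have htA : t ∈ A.rel R := hrel _ hR' ht'
    obtain ⟨e, he, hte⟩ := hA'H t.toFinset (Finset.mem_biUnion.2 ⟨.inl R, by rwa [hv],
      Finset.mem_image_of_mem _ ht'⟩)
    obtain ⟨r, hr, hgr⟩ := hg ⟨e, he⟩
    obtain ⟨hb1, hb2⟩ := hview.base_view R hR t htA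
    obtain ⟨r', hr', hc⟩ := hext _ ((Finset.mem_sort _).2 (hF1 ⟨e, he⟩)) _ ((Finset.mem_sort _).2 hb1) r hr
    obtain ⟨u, hu, rfl⟩ := hrow _ r' hr'
    have hl := hlen _ hb1 u hu
    rw [viewVars_eq hb2] at hl hc
    rw [map_eq_of_zip hl]
    · exact hlegal.base_subset R hR t htA hu
    · rintro ⟨x, b⟩ hx
      have hxe : x ∈ e := hte (List.mem_toFinset.2 (List.of_mem_zip hx).1)
      obtain ⟨a, ha⟩ := hdom _ (hF1 ⟨e, he⟩) r hr x (List.mem_toFinset.1 (hF2 ⟨e, he⟩ hxe))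
      exact (hgr _ ha hxe).trans (compat_iff.1 hc _ ha _ hx rfl)
  let k : ℕ → ℕ := fun x => if g x ∈ B.univ then g x else B.univ.sort.headD 0
  have hk : ∀ R ∈ A.vocab, ∀ t ∈ A'.rel (.inl R), t.map k = t.map g := fun R hR t ht' =>
    List.map_congr_left fun x hx => if_pos (B.mem_univ R _ (htuple R hR t ht') _ (List.mem_map_of_mem hx))
  refine ⟨fun x => k (f x), fun x hx => ?_, fun R hR t ht' => ?_⟩
  · simp only [k]
    split_ifs with h
    · exact h
    · rcases hne with h' | h'
      · simp [h'] at hx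
      · have : B.univ.sort ≠ [] := by rwa [Ne, ← List.isEmpty_iff, sort_isEmpty]
        rw [← Finset.mem_sort (· ≤ ·)]
        cases hs : B.univ.sort with
        | nil => exact absurd hs this
        | cons a l => simp
  · have hR' : (Sum.inl R : Symbol ⊕ MarkSymbol) ∈ (A.disjUnion (marks O)).vocab :=
      Finset.inl_mem_disjSum.2 hR
    have h1 := hf.2 (.inl R) hR' t ht'
    have : t.map (fun x => k (f x)) = (t.map f).map k := by simp
    rw [this, hk R hR _ h1]
    exact htuple R hR _ h1

/-! ## The test runs in polynomial time -/

/-- The lists by which a structure is encoded. -/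
def RelStr.rep (A : Str) : List ℕ × List (Symbol × List (List ℕ)) :=
  (A.univ.sort, A.vocab.sort.map fun R => (R, (A.rel R).sort))

theorem enc_rep (A : Str) : enc A.rep = enc A := by
  rw [RelStr.rep, enc_pair, enc_list_map]
  rfl

/-- The structure `B` with the domains of the variables in `p` restricted to their values in `p`. -/
def pin (B : Str) (p : Row) : Str where
  univ := B.univ
  vocab := B.vocab
  rel R := (B.rel R).filter fun t => (p.all fun x => !decide (R = .dom x.1) || decide (t = [x.2])) = true
  length_eq R t ht := B.length_eq R t (Finset.mem_of_mem_filter t ht)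
  mem_univ R t ht := B.mem_univ R t (Finset.mem_of_mem_filter t ht)
  rel_eq_empty R hR := by rw [B.rel_eq_empty R hR, Finset.filter_empty]

theorem sort_filter {α : Type} [LinearOrder α] (s : Finset α) (p : α → Bool) :
    (s.filter fun x => p x = true).sort = s.sort.filter p := by
  refine List.Perm.eq_of_pairwise (fun a b _ _ h h' => le_antisymm h h') (Finset.pairwise_sort _ _)
    ((Finset.pairwise_sort _ _).filter _) ?_
  refine (List.perm_ext_iff_of_nodup (Finset.sort_nodup _ _) ((Finset.sort_nodup _ _).filter _)).2 ?_
  simp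

theorem rep_pin (B : Str) (p : Row) : (pin B p).rep = (B.rep.1, B.rep.2.map fun y =>
    (y.1, y.2.filter fun t => p.all fun x => !decide (y.1 = .dom x.1) || decide (t = [x.2]))) := by
  simp only [RelStr.rep, pin, sort_filter, List.map_map]
  rfl

theorem headD_filter_rep (W : Str) (R : Symbol) :
    ((W.rep.2.filter fun y => decide (y.1 = R)).map Prod.snd).headD [] = (W.rel R).sort := by
  have h : ∀ l : List Symbol, (R ∉ l → W.rel R = ∅) →
      (((l.map fun S => (S, (W.rel S).sort)).filter fun y => decide (y.1 = R)).map Prod.snd).headD [] =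
        (W.rel R).sort := by
    intro l
    induction l with
    | nil => intro h; simp [h]
    | cons S l ih =>
      intro h
      by_cases hS : S = R
      · subst hS; simp
      · rw [List.map_cons, List.filter_cons_of_neg (by simpa using hS)]
        exact ih fun hl => h (by simp [hl, Ne.symm hS])
  exact h _ fun hR => W.rel_eq_empty R (by simpa using hR)

theorem tables_eq (V W : Str) : tables V W = V.rep.2.map fun x =>
    (((W.rep.2.filter fun y => decide (y.1 = x.1)).map Prod.snd).headD []).map fun u =>
      (x.2.headD []).zip u := by
  simp only [headD_filter_rep]
  simp only [tables, RelStr.rep, List.map_map]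
  rfl

theorem sz_prune_le (T : List (List Row)) : sz (prune T) ≤ sz T := by
  have h : ∀ p : Row → Bool, sz (T.map fun R => R.filter p) ≤ sz T := by
    intro p
    induction T with
    | nil => exact le_rfl
    | cons R T ih =>
      have := sz_le_of_sublist (List.filter_sublist (p := p) (l := R))
      rw [List.map_cons, sz_cons, sz_cons]
      omega
  exact h _

namespace PolyTime

variable {α β : Type} [Enc α] [Enc β]

theorem rep {f : α → Str} (hf : PolyTime f) : PolyTime fun a => (f a).rep :=
  hf.cast fun a => enc_rep (f a)

theorem nat_eq {f g : α → ℕ} (hf : PolyTime f) (hg : PolyTime g) :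
    PolyTime fun a => decide (f a = g a) := eq encNat_injective hf hg

theorem zip {l : α → List β} {l' : α → List ℕ} (hl : PolyTime l) (hl' : PolyTime l') :
    PolyTime fun a => (l a).zip (l' a) := by
  let g : List (β × ℕ) × List ℕ → β → List (β × ℕ) × List ℕ := fun c x =>
    if c.2.isEmpty then c else ((x, c.2.headD 0) :: c.1, c.2.tail)
  refine (foldl_add (g := fun _ c x => g c x) (γ := List (β × ℕ) × List ℕ) hl ((const []).pair hl') ?_
    (q := fun a => 1 + sz (l a)) ((PolyBd.const 1).add hl.bound) ?_).fst.reverse.cast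
    (f' := fun a => (l a).zip (l' a)) fun a => ?_
  · exact id.snd.fst.snd.isEmpty.ite id.snd.fst
      (((id.snd.snd.pair (id.snd.fst.snd.headD_of_nil (by simp [enc, encNat, encList]))).cons
        id.snd.fst.fst).pair id.snd.fst.snd.tail)
  · rintro a ⟨c, l'⟩ x hx
    have := sz_le_of_mem hx
    cases l' with
    | nil => simp [g]
    | cons y l' =>
      simp only [g, List.isEmpty_cons, Bool.false_eq_true, if_false, List.headD_cons, List.tail_cons,
        sz_pair, sz_cons]
      omega
  · suffices h : ∀ (l : List β) (c : List (β × ℕ) × List ℕ),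
        (l.foldl g c).1.reverse = c.1.reverse ++ l.zip c.2 by
      rw [h]; rfl
    intro l
    induction l with
    | nil => simp
    | cons x l ih =>
      rintro ⟨c, _ | ⟨y, l'⟩⟩
      · rw [List.foldl_cons, ih]; simp [g]
      · rw [List.foldl_cons, ih]; simp [g]

theorem compat {r r' : α → Row} (hr : PolyTime r) (hr' : PolyTime r') :
    PolyTime fun a => compat (r a) (r' a) := by
  have h : PolyTime fun x : Row × Row => ECSP.compat x.1 x.2 :=
    id.fst.all (id.fst.snd.all ((nat_eq id.fst.snd.fst id.snd.fst).not.or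
      (nat_eq id.fst.snd.snd id.snd.snd)))
  exact h.comp (hr.pair hr')

theorem prune {T : α → List (List Row)} (hT : PolyTime T) : PolyTime fun a => prune (T a) := by
  have h : PolyTime fun T : List (List Row) => ECSP.prune T :=
    id.map (id.snd.filter ((id.snd.compat id.snd).and
      (id.fst.fst.all (id.snd.any (id.fst.fst.snd.compat id.snd)))))
  exact h.comp hT

theorem consistent {T : α → List (List Row)} (hT : PolyTime T) :
    PolyTime fun a => consistent (T a) :=
  ((foldl_add hT.flatten hT id.snd.fst.prune (.const 0) fun _ c _ _ => sz_prune_le c).all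
    id.snd.isEmpty.not)

theorem tables {V W : α → Str} (hV : PolyTime V) (hW : PolyTime W) :
    PolyTime fun a => tables (V a) (W a) := by
  have h : PolyTime fun a => (V a).rep.2.map fun x =>
      ((((W a).rep.2.filter fun y => decide (y.1 = x.1)).map Prod.snd).headD []).map fun u =>
        (x.2.headD []).zip u :=
    hV.rep.snd.map ((((((hW.comp id.fst).rep.snd.filter
      (eq encSymbol_injective id.snd.fst id.fst.snd.fst)).map id.snd.snd).headD_of_nil rfl)).map
        ((id.fst.snd.snd.headD_of_nil rfl).zip id.snd))
  exact h.cast fun a => by rw [tables_eq]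

theorem homTest (DM : DecompositionMethod) :
    PolyTime fun I : {I : Str × Str // I.2.vocab = I.1.vocab} => homTest DM I.1.1 I.1.2 := by
  have h : PolyTime fun I : {I : Str × Str // I.2.vocab = I.1.vocab} => I.1 := id.cast fun _ => rfl
  have hl : PolyTime fun I : {I : Str × Str // I.2.vocab = I.1.vocab} => DM.lDM I.1.1 := by
    refine comp (f := fun I : {I : Str × Str // I.2.vocab = I.1.vocab} => (⟨I.1.1, trivial⟩ :
      {A : Str // True})) (of_polyTimeComputableOn DM.lDM_polyTime) (h.fst.cast fun _ => rfl)
  have hr : PolyTime fun I : {I : Str × Str // I.2.vocab = I.1.vocab} => DM.rDM I.1.1 I.1.2 :=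
    of_polyTimeComputableOn DM.rDM_polyTime
  exact (h.fst.rep.fst.isEmpty.or h.snd.rep.fst.isEmpty.not).and (hl.tables hr).consistent

theorem pin {B : α → Str} {p : α → Row} (hB : PolyTime B) (hp : PolyTime p) :
    PolyTime fun a => pin (B a) (p a) := by
  have h : PolyTime fun a => ((B a).rep.1, (B a).rep.2.map fun y =>
      (y.1, y.2.filter fun t => (p a).all fun x =>
        !decide (y.1 = .dom x.1) || decide (t = [x.2]))) := by
    refine hB.rep.fst.pair (hB.rep.snd.map (id.snd.fst.pair (id.snd.snd.filter
      ((hp.comp id.fst.fst).all ((eq encSymbol_injective id.fst.fst.snd.fst ?_).not.or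
        (eq (encList_injective encNat_injective) id.fst.snd (id.snd.snd.cons (const []))))))))
    exact ((const 1).cons (id.snd.fst.cons (const []))).cast fun _ => rfl
  exact h.cast fun a => by rw [← enc_rep, rep_pin]

end PolyTime

/-! ## Backtracking -/

/-- A node of the search tree: the variables still to be assigned, and the values of the others. -/
abbrev Node := List ℕ × Row

section Search

variable (DM : DecompositionMethod) (I : Instance)

/-- The partial assignment `p` passes the test. -/
def live (p : Row) : Bool := homTest DM I.A (pin I.B p)

/-- The extensions of `p` to the variable `X` that pass the test. -/
def childRows (X : ℕ) (p : Row) : List Row :=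
  (I.B.univ.sort.filter fun v => live DM I ((X, v) :: p)).map fun v => (X, v) :: p

/-- Replace the top of the stack by its children. -/
def expand : List Node → List Node
  | [] => []
  | ([], p) :: st => ([], p) :: st
  | (X :: r, p) :: st => (childRows DM I X p).map (fun q => (r, q)) ++ st

/-- Expand the stack until its top is a complete assignment. -/
def advance (st : List Node) : List Node := I.O.sort.foldl (fun st _ => expand DM I st) st

/-- The initial stack. -/
def initStack : List Node := if live DM I [] then [(I.O.sort.reverse, [])] else []

/-- The complete assignments below a node. -/
def extensions : List ℕ → Row → List Row
  | [], p => [p]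
  | X :: r, p => (childRows DM I X p).flatMap (extensions r)

/-- The complete assignments below the nodes of a stack. -/
def stackRows (st : List Node) : List Row := st.flatMap fun n => extensions DM I n.1 n.2

/-- The nodes that occur in the search. -/
structure GoodNode (n : Node) : Prop where
  vars : n.1.reverse ++ n.2.map Prod.fst = I.O.sort
  vals : ∀ x ∈ n.2, x.2 ∈ I.B.univ
  live : live DM I n.2 = true

/-- The stacks that occur in the search. -/
def GoodStack : List Node → Prop
  | [] => True
  | n :: st => GoodNode DM I n ∧ st.length ≤ I.B.univ.card * n.2.length ∧ GoodStack st

variable {DM I}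

theorem mem_childRows {X : ℕ} {p q : Row} : q ∈ childRows DM I X p ↔
    ∃ v ∈ I.B.univ, live DM I ((X, v) :: p) = true ∧ (X, v) :: p = q := by
  simp [childRows, and_assoc]

theorem length_childRows_le (X : ℕ) (p : Row) : (childRows DM I X p).length ≤ I.B.univ.card := by
  rw [childRows, List.length_map, ← Finset.length_sort (· ≤ ·)]
  exact List.length_filter_le _ _

theorem GoodNode.child {X : ℕ} {r : List ℕ} {p q : Row} (h : GoodNode DM I (X :: r, p))
    (hq : q ∈ childRows DM I X p) : GoodNode DM I (r, q) := by
  obtain ⟨v, hv, hl, rfl⟩ := mem_childRows.1 hq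
  refine ⟨by simpa using h.vars, fun x hx => ?_, hl⟩
  rcases List.mem_cons.1 hx with rfl | hx
  · exact hv
  · exact h.vals x hx

theorem GoodStack.append_children {r : List ℕ} {m : ℕ} {st : List Node} (hst : GoodStack DM I st)
    (hm : st.length ≤ I.B.univ.card * m) : ∀ l : List Row, l.length ≤ I.B.univ.card →
      (∀ q ∈ l, GoodNode DM I (r, q) ∧ q.length = m + 1) →
      GoodStack DM I (l.map (fun q => (r, q)) ++ st)
  | [], _, _ => hst
  | q :: l, hl, h => by
    rw [List.length_cons] at hl
    refine ⟨(h q (by simp)).1, ?_, append_children hst hm l (by omega) fun q hq => h q (by simp [hq])⟩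
    change (l.map _ ++ st).length ≤ _ * q.length
    rw [(h q (by simp)).2, List.length_append, List.length_map, Nat.mul_succ]
    omega

theorem GoodStack.expand {st : List Node} (h : GoodStack DM I st) : GoodStack DM I (expand DM I st) := by
  rcases st with _ | ⟨⟨_ | ⟨X, r⟩, p⟩, st⟩
  · exact h
  · exact h
  · refine h.2.2.append_children h.2.1 _ (length_childRows_le X p) fun q hq => ⟨h.1.child hq, ?_⟩
    obtain ⟨v, -, -, rfl⟩ := mem_childRows.1 hq
    rfl

theorem stackRows_expand (st : List Node) : stackRows DM I (expand DM I st) = stackRows DM I st := by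
  rcases st with _ | ⟨⟨_ | ⟨X, r⟩, p⟩, st⟩
  · rfl
  · rfl
  · simp [stackRows, expand, extensions, List.flatMap_map]

theorem advance_eq (st : List Node) : advance DM I st = (expand DM I)^[I.O.card] st := by
  rw [advance, List.foldl_const, Finset.length_sort]

theorem GoodStack.iterate {st : List Node} (h : GoodStack DM I st) (n : ℕ) :
    GoodStack DM I ((ECSP.expand DM I)^[n] st) := by
  induction n with
  | zero => exact h
  | succ n ih => rw [Function.iterate_succ_apply']; exact ih.expand

theorem GoodStack.advance {st : List Node} (h : GoodStack DM I st) : GoodStack DM I (advance DM I st) := by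
  rw [advance_eq]
  exact h.iterate _

theorem stackRows_advance (st : List Node) : stackRows DM I (advance DM I st) = stackRows DM I st := by
  rw [advance_eq]
  induction I.O.card with
  | zero => rfl
  | succ n ih => rw [Function.iterate_succ_apply', stackRows_expand, ih]

theorem goodStack_initStack : GoodStack DM I (initStack DM I) := by
  rw [initStack]
  split_ifs with h
  · exact ⟨⟨by simp, by simp, h⟩, Nat.zero_le _, trivial⟩
  · trivial

/-! ### Correctness -/

theorem isHom_pin_iff {p : Row} (hp : ∀ x ∈ p, x.1 ∈ drv I.A) {h : ℕ → ℕ} :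
    IsHom I.A (pin I.B p) h ↔ IsHom I.A I.B h ∧ ∀ x ∈ p, h x.1 = x.2 := by
  simp only [IsHom, pin, Finset.mem_filter, List.all_eq_true, Bool.or_eq_true, Bool.not_eq_true',
    decide_eq_false_iff_not, decide_eq_true_eq]
  refine ⟨fun ⟨h1, h2⟩ => ⟨⟨h1, fun R hR t ht => (h2 R hR t ht).1⟩, fun x hx => ?_⟩,
    fun ⟨⟨h1, h2⟩, h3⟩ => ⟨h1, fun R hR t ht => ⟨h2 R hR t ht, fun x hx => ?_⟩⟩⟩
  · have hd := hp x hx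
    rw [drv, Finset.mem_filter] at hd
    have := (h2 _ hd.2.1 [x.1] (by rw [hd.2.2]; simp)).2 x hx
    simpa using this
  · by_cases hR' : R = .dom x.1
    · right
      have hd := hp x hx
      rw [drv, Finset.mem_filter] at hd
      rw [hR', hd.2.2, Finset.mem_singleton] at ht
      rw [ht, ← h3 x hx]
      rfl
    · exact .inl hR'

theorem GoodNode.mem_fst {n : Node} (h : GoodNode DM I n) : ∀ x ∈ n.2, x.1 ∈ I.O := fun x hx => by
  rw [← Finset.mem_sort (· ≤ ·), ← h.vars]
  exact List.mem_append_right _ (List.mem_map_of_mem hx)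

theorem live_iff (hI : TPCovered DM I.A (drv I.A)) (hO : I.O ⊆ drv I.A)
    {p : Row} (hp : ∀ x ∈ p, x.1 ∈ I.O) :
    live DM I p = true ↔ ∃ h, IsHom I.A I.B h ∧ ∀ x ∈ p, h x.1 = x.2 := by
  simp only [← isHom_pin_iff fun x hx => hO (hp x hx)]
  exact ⟨exists_isHom_of_homTest DM (B := pin I.B p) I.vocab_eq hI, fun ⟨h, hh⟩ =>
    homTest_of_isHom DM (B := pin I.B p) I.vocab_eq hh⟩

theorem mem_extensions (hI : TPCovered DM I.A (drv I.A)) (hO : I.O ⊆ drv I.A)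
    {r : List ℕ} {p : Row} (hn : GoodNode DM I (r, p)) (d : Row) :
    d ∈ extensions DM I r p ↔ ∃ h, IsHom I.A I.B h ∧ (∀ x ∈ p, h x.1 = x.2) ∧
      d = r.reverse.map (fun X => (X, h X)) ++ p := by
  induction r generalizing p with
  | nil =>
    obtain ⟨h, hh⟩ := (live_iff hI hO hn.mem_fst).1 hn.live
    simp only [extensions, List.mem_singleton, List.reverse_nil, List.map_nil, List.nil_append]
    exact ⟨fun hd => ⟨h, hh.1, hh.2, hd⟩, fun ⟨_, _, _, hd⟩ => hd⟩
  | cons X r ih =>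
    simp only [extensions, List.mem_flatMap]
    have hX : X ∈ I.O := by
      rw [← Finset.mem_sort (· ≤ ·), ← hn.vars]
      simp
    constructor
    · rintro ⟨q, hq, hd⟩
      obtain ⟨h, h1, h2, rfl⟩ := (ih (hn.child hq)).1 hd
      obtain ⟨v, hv, hl, rfl⟩ := mem_childRows.1 hq
      refine ⟨h, h1, fun x hx => h2 x (by simp [hx]), ?_⟩
      have := h2 (X, v) (by simp)
      simp only at this
      simp [this]
    · rintro ⟨h, h1, h2, rfl⟩
      have h3 : ∀ x ∈ (X, h X) :: p, h x.1 = x.2 := fun x hx => by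
        rcases List.mem_cons.1 hx with rfl | hx
        · rfl
        · exact h2 x hx
      have h4 : (X, h X) :: p ∈ childRows DM I X p := by
        refine mem_childRows.2 ⟨_, h1.1 X (I.subset_univ hX), (live_iff hI hO fun x hx => ?_).2
          ⟨h, h1, h3⟩, rfl⟩
        rcases List.mem_cons.1 hx with rfl | hx
        · exact hX
        · exact hn.mem_fst x hx
      exact ⟨_, h4, (ih (hn.child h4)).2 ⟨h, h1, h3, by simp⟩⟩

theorem nodup_extensions (hI : TPCovered DM I.A (drv I.A)) (hO : I.O ⊆ drv I.A)
    {r : List ℕ} {p : Row} (hn : GoodNode DM I (r, p)) :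
    (extensions DM I r p).Nodup := by
  induction r generalizing p with
  | nil => simp [extensions]
  | cons X r ih =>
    rw [extensions, List.nodup_flatMap]
    refine ⟨fun q hq => ih (hn.child hq), ?_⟩
    have hnd : (childRows DM I X p).Nodup :=
      ((Finset.sort_nodup _ _).filter _).map fun v w h => by simpa using h
    refine hnd.imp_of_mem fun {q q'} hq hq' hne => ?_
    intro d hd hd'
    obtain ⟨h, -, -, rfl⟩ := (mem_extensions hI hO (hn.child hq) d).1 hd
    obtain ⟨h', -, -, e⟩ := (mem_extensions hI hO (hn.child hq') _).1 hd'
    exact hne (List.append_inj e (by simp)).2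

theorem stackRows_initStack_nodup (hI : TPCovered DM I.A (drv I.A)) (hO : I.O ⊆ drv I.A)
    : (stackRows DM I (initStack DM I)).Nodup := by
  have hg := goodStack_initStack (DM := DM) (I := I)
  rw [initStack] at hg ⊢
  split_ifs with h
  · rw [if_pos h] at hg
    simpa [stackRows] using nodup_extensions hI hO hg.1
  · simp [stackRows]

theorem mem_stackRows_initStack (hI : TPCovered DM I.A (drv I.A)) (hO : I.O ⊆ drv I.A)
    (d : Row) :
    d ∈ stackRows DM I (initStack DM I) ↔ d ∈ solutions I := by
  have hg := goodStack_initStack (DM := DM) (I := I)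
  rw [initStack] at hg ⊢
  split_ifs with h
  · rw [if_pos h] at hg
    have := mem_extensions hI hO hg.1 d
    simp only [List.reverse_reverse, List.append_nil] at this
    simp only [stackRows, List.flatMap_cons, List.flatMap_nil, List.append_nil, this, solutions,
      restrict, Set.mem_ofPred_eq]
    exact ⟨fun ⟨h, h1, _, h3⟩ => ⟨h, h1, h3.symm⟩, fun ⟨h, h1, h3⟩ => ⟨h, h1, by simp, h3.symm⟩⟩
  · simp only [stackRows, List.flatMap_nil, List.not_mem_nil, false_iff]
    rintro ⟨f, hf, -⟩
    exact h ((live_iff hI hO (by simp)).2 ⟨f, hf, by simp⟩)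

theorem childRows_ne_nil (hI : TPCovered DM I.A (drv I.A)) (hO : I.O ⊆ drv I.A)
    {X : ℕ} {r : List ℕ} {p : Row} (hn : GoodNode DM I (X :: r, p)) :
    childRows DM I X p ≠ [] := by
  obtain ⟨h, hh⟩ := (live_iff hI hO hn.mem_fst).1 hn.live
  have := (mem_extensions hI hO hn _).2 ⟨h, hh.1, hh.2, rfl⟩
  intro h0
  simp [extensions, h0] at this

theorem iterate_expand (hI : TPCovered DM I.A (drv I.A)) (hO : I.O ⊆ drv I.A)
    {st : List Node} (hst : GoodStack DM I st) (n : ℕ) :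
    ∀ N ∈ ((expand DM I)^[n] st).head?, N.1.length ≤ I.O.card - n := by
  induction n with
  | zero =>
    rcases st with _ | ⟨N, st⟩
    · simp
    · have := congrArg List.length hst.1.vars
      rw [List.length_append, List.length_reverse, Finset.length_sort] at this
      simp only [Function.iterate_zero, id_eq, List.head?_cons, Option.mem_some_iff, forall_eq']
      omega
  | succ n ih =>
    have hg := hst.iterate n
    rw [Function.iterate_succ_apply']
    generalize (expand DM I)^[n] st = st' at ih hg
    rcases st' with _ | ⟨⟨_ | ⟨X, r⟩, p⟩, st'⟩
    · simp [expand]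
    · simp [expand]
    · have h1 := ih (X :: r, p) rfl
      have h2 := childRows_ne_nil hI hO hg.1
      obtain ⟨q, l, hq⟩ := List.exists_cons_of_ne_nil h2
      simp only [expand, hq, List.map_cons, List.cons_append, List.head?_cons, Option.mem_some_iff,
        forall_eq']
      simp only [List.length_cons] at h1
      omega

theorem advance_top (hI : TPCovered DM I.A (drv I.A)) (hO : I.O ⊆ drv I.A)
    {st st' : List Node} {N : Node} (hst : GoodStack DM I st)
    (h : advance DM I st = N :: st') : N.1 = [] := by
  have := iterate_expand hI hO hst I.O.card N (by rw [← advance_eq, h]; rfl)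
  rw [Nat.sub_self] at this
  exact List.length_eq_zero_iff.1 (Nat.le_zero.1 this)

end Search

/-! ## The search runs in polynomial time -/

/-- A bound for the sizes of the stacks that occur in the search. -/
def stackBound (I : Instance) : ℕ :=
  1 + (sz I * sz I + 1) * (1 + (1 + sz I * (sz I + 1)) + (1 + sz I * ((1 + sz I + sz I) + 1)) + 1)

theorem sz_instance (I : Instance) : sz I = 1 + sz I.A + (1 + sz I.B + sz I.O.sort) := rfl

theorem polyBd_stackBound : PolyBd stackBound := by
  have h : PolyBd fun I : Instance => sz I := .size
  have h1 : ∀ n : ℕ, PolyBd fun _ : Instance => n := .const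
  exact (h1 1).add (((h.mul h).add (h1 1)).mul (((((h1 1).add ((h1 1).add (h.mul (h.add (h1 1))))).add
    ((h1 1).add (h.mul ((((h1 1).add h).add h).add (h1 1))))).add (h1 1))))

theorem sz_rep (A : Str) : sz A.rep = sz A := congrArg Data.size (enc_rep A)

theorem GoodStack.sz_le {DM : DecompositionMethod} {I : Instance} {st : List Node}
    (h : GoodStack DM I st) : sz st ≤ stackBound I := by
  have hI := sz_instance I
  have hB : sz I.B.univ.sort ≤ sz I.B := by
    rw [← sz_rep, RelStr.rep, sz_pair]
    omega
  have hcard : I.B.univ.card ≤ sz I := by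
    rw [← Finset.length_sort (· ≤ ·)]
    have := length_lt_sz I.B.univ.sort
    omega
  have hOcard := length_lt_sz I.O.sort
  have hnode : ∀ n, GoodNode DM I n → n.2.length ≤ sz I ∧
      sz n ≤ 1 + (1 + sz I * (sz I + 1)) + (1 + sz I * ((1 + sz I + sz I) + 1)) := by
    rintro ⟨r, p⟩ hn
    have hlen := congrArg List.length hn.vars
    rw [List.length_append, List.length_reverse, List.length_map] at hlen
    have hmem : ∀ x ∈ r.reverse ++ p.map Prod.fst, sz x ≤ sz I := fun x hx => by
      rw [hn.vars] at hx
      have := sz_le_of_mem hx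
      omega
    have h1 : sz r ≤ 1 + r.length * (sz I + 1) :=
      sz_le_of_forall fun x hx => hmem x (by simp [hx])
    have h2 : sz p ≤ 1 + p.length * ((1 + sz I + sz I) + 1) := by
      refine sz_le_of_forall fun x hx => ?_
      have h3 := hmem x.1 (List.mem_append_right _ (List.mem_map_of_mem hx))
      have h4 := sz_le_of_mem ((Finset.mem_sort (· ≤ ·)).2 (hn.vals x hx))
      rw [← Prod.mk.eta (p := x), sz_pair]
      omega
    simp only at hlen
    have h3 : r.length * (sz I + 1) ≤ sz I * (sz I + 1) := Nat.mul_le_mul_right _ (by omega)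
    have h4 : p.length * ((1 + sz I + sz I) + 1) ≤ sz I * ((1 + sz I + sz I) + 1) :=
      Nat.mul_le_mul_right _ (by omega)
    refine ⟨by simp only; omega, ?_⟩
    rw [sz_pair]
    omega
  have hall : ∀ st : List Node, GoodStack DM I st → ∀ n ∈ st, GoodNode DM I n := by
    intro st
    induction st with
    | nil => simp
    | cons m st ih =>
      intro hst n hn
      rcases List.mem_cons.1 hn with rfl | hn
      · exact hst.1
      · exact ih hst.2.2 n hn
  have hlen : st.length ≤ sz I * sz I + 1 := by
    rcases st with _ | ⟨n, st⟩
    · simp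
    · have := h.2.1.trans (Nat.mul_le_mul hcard (hnode n h.1).1)
      rw [List.length_cons]
      omega
  exact (sz_le_of_forall fun n hn => (hnode n (hall st h n hn)).2).trans
    (Nat.add_le_add_left (Nat.mul_le_mul_right _ hlen) _)

namespace PolyTime

variable {α : Type} [Enc α]

theorem instA {f : α → Instance} (hf : PolyTime f) : PolyTime fun a => (f a).A :=
  (hd.comp (encode.comp hf)).cast fun _ => rfl

theorem instB {f : α → Instance} (hf : PolyTime f) : PolyTime fun a => (f a).B :=
  (hd.comp (tl.comp (encode.comp hf))).cast fun _ => rfl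

theorem instO {f : α → Instance} (hf : PolyTime f) : PolyTime fun a => (f a).O.sort :=
  (tl.comp (tl.comp (encode.comp hf))).cast fun _ => rfl

variable (DM : DecompositionMethod)

theorem live {f : α → Instance} {p : α → Row} (hf : PolyTime f) (hp : PolyTime p) :
    PolyTime fun a => live DM (f a) (p a) := by
  refine comp (f := fun a => (⟨((f a).A, ECSP.pin (f a).B (p a)), (f a).vocab_eq⟩ :
    {I : Str × Str // I.2.vocab = I.1.vocab})) (homTest DM) ?_
  exact (hf.instA.pair (hf.instB.pin hp)).cast fun _ => rfl

theorem childRows {f : α → Instance} {X : α → ℕ} {p : α → Row} (hf : PolyTime f) (hX : PolyTime X)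
    (hp : PolyTime p) : PolyTime fun a => childRows DM (f a) (X a) (p a) := by
  have h : PolyTime fun x : α × ℕ => (X x.1, x.2) :: p x.1 :=
    ((hX.comp id.fst).pair id.snd).cons (hp.comp id.fst)
  exact hf.instB.rep.fst.filter_map (live DM (hf.comp id.fst) h) h

theorem expand {f : α → Instance} {st : α → List Node} (hf : PolyTime f) (hst : PolyTime st) :
    PolyTime fun a => expand DM (f a) (st a) := by
  have h1 : PolyTime fun a => ((st a).map Prod.fst).headD [] := (hst.map id.snd.fst).headD_of_nil rfl
  have h2 : PolyTime fun a => ((st a).map Prod.snd).headD [] := (hst.map id.snd.snd).headD_of_nil rfl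
  have h3 := childRows DM hf (h1.headD_of_nil (b := 0) (by simp [enc, encNat, encList])) h2
  refine ((hst.isEmpty.or h1.isEmpty).ite hst ((h3.map (f := fun a q =>
    ((((st a).map Prod.fst).headD []).tail, q)) ((h1.tail.comp id.fst).pair id.snd)).append
      hst.tail)).cast fun a => ?_
  rcases st a with _ | ⟨⟨_ | ⟨X, r⟩, p⟩, st⟩ <;> rfl

theorem advance : PolyTime fun x : {x : Instance × List Node // GoodStack DM x.1 x.2} =>
    advance DM x.1.1 x.1.2 := by
  let S := {x : Instance × List Node // GoodStack DM x.1 x.2}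
  have h : PolyTime fun x : S => x.1 := id.cast fun _ => rfl
  have hI : PolyTime fun x : S => x.1.1 := h.fst
  have he : PolyTime fun x : S × List Node × ℕ => ECSP.expand DM x.1.1.1 x.2.1 :=
    expand DM (hI.comp id.fst) id.snd.fst
  have hB : PolyBd fun x : S => stackBound x.1.1 := polyBd_stackBound.comp hI.bound
  exact foldl (α := S) (β := ℕ) (γ := List Node) (l := fun x => x.1.1.O.sort) (b := fun x => x.1.2)
    (g := fun x st _ => ECSP.expand DM x.1.1 st) hI.instO h.snd he
    (fun x _ st => GoodStack DM x.1.1 st) hB (fun _ _ _ hst => hst.sz_le) (fun x => x.2)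
    fun _ _ _ _ _ hst => hst.expand

theorem initStack : PolyTime fun I : Instance => initStack DM I :=
  (live DM id (const [])).ite ((id.instO.reverse.pair (const [])).cons (const [])) (const [])

theorem advance_initStack : PolyTime fun I : Instance => ECSP.advance DM I (ECSP.initStack DM I) :=
  comp (f := fun I : Instance => (⟨(I, ECSP.initStack DM I), goodStack_initStack⟩ :
    {x : Instance × List Node // GoodStack DM x.1 x.2})) (advance DM)
    ((id.pair (initStack DM)).cast fun _ => rfl)

end PolyTime

/-! ## The enumeration -/

theorem Output.delay_delay (k l : ℕ) (L : Output) : (L.delay l).delay k = L.delay (k + l) := by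
  simp [Output.delay, Nat.add_assoc]

theorem Output.delay_append (k : ℕ) (L M : Output) : (L ++ M).delay k = L.delay k ++ M.delay k :=
  List.map_append

theorem Output.map_snd_delay (k : ℕ) (L : Output) : (L.delay k).map Prod.snd = L.map Prod.snd := by
  simp [Output.delay]

/-- Output the top of the stack and compute the next stack, using `c`. -/
def loopBody (N : ℕ) (c : Prog) : Prog :=
  .seq (.emit (.tl (.hd (.var 0)))) (.seq (.assign 0 (.cons (.var (N + 1)) (.tl (.var 0)))) c)

theorem exec_loop {DM : DecompositionMethod} {I : Instance} (hI : TPCovered DM I.A (drv I.A))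
    (hO : I.O ⊆ drv I.A) {c : Prog} {N t : ℕ}
    (hc : ∀ st, GoodStack DM I st → ∀ s : Store, s 0 = enc (I, st) →
      Runs c s t fun s' => s' 0 = enc (advance DM I st) ∧ ∀ y > N, s' y = s y)
    {m₁ m₂ : ℕ} (hm₁ : 4 * stackBound I ≤ m₁) (hm₂ : 1 + 2 * sz I + 4 * stackBound I + t ≤ m₂)
    (rows : List Row) :
    ∀ st, GoodStack DM I st → (∀ n ∈ st.head?, n.1 = []) → stackRows DM I st = rows →
      ∀ s : Store, s 0 = enc st → s (N + 1) = enc I →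
        ∃ s' k L, Exec (.while (.var 0) (loopBody N c)) s s' k L ∧ L.map Prod.snd = rows.map enc ∧
          ∀ a b, a ≤ b + m₂ →
            (b :: ((L.delay a).map Prod.fst ++ [a + k])).IsChain fun u v => v ≤ u + (m₁ + m₂) := by
  induction rows with
  | nil =>
    rintro (_ | ⟨⟨r, p⟩, st⟩) hst htop hrows s h0 hN
    · refine ⟨s, _, [], .while_false h0, rfl, fun a b hab => ?_⟩
      have : (Expr.var 0).cost s ≤ stackBound I := by
        rw [Expr.cost, h0]
        exact hst.sz_le
      simp only [Output.delay, List.map_nil, List.nil_append, List.isChain_cons_cons,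
        List.isChain_singleton, and_true]
      omega
    · obtain rfl : r = [] := htop _ rfl
      simp [stackRows, extensions] at hrows
  | cons d rows ih =>
    rintro (_ | ⟨⟨r, p⟩, st⟩) hst htop hrows s h0 hN
    · simp [stackRows] at hrows
    obtain rfl : r = [] := htop _ rfl
    have hrows' : p :: stackRows DM I st = d :: rows := by simpa [stackRows, extensions] using hrows
    rw [List.cons.injEq] at hrows'
    obtain ⟨rfl, hrows'⟩ := hrows'
    have hsz : sz (([], p) :: st) ≤ stackBound I := hst.sz_le
    rw [sz_cons, sz_pair] at hsz
    have h0' : s 0 = .cons (.cons .nil (enc p)) (enc st) := h0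
    simp only [sz] at hsz
    have e1 : (Expr.tl (.hd (.var 0))).eval s = enc p := by simp [Expr.eval, h0', Data.hd, Data.tl]
    have c0 : (Expr.var 0).cost s ≤ stackBound I := by
      rw [Expr.cost, h0]
      exact hst.sz_le
    have c1 : (Expr.tl (.hd (.var 0))).cost s ≤ 3 * stackBound I := by
      simp only [Expr.cost, Expr.eval, h0', Data.hd, Data.tl, Data.size]
      omega
    have hassign : Runs (.seq (.assign 0 (.cons (.var (N + 1)) (.tl (.var 0)))) c) s
        (1 + 2 * sz I + 4 * stackBound I + t) fun s' => s' 0 = enc (advance DM I st) ∧ s' (N + 1) = enc I := by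
      refine .seq (.assign (enc (I, st)) ?_ ?_ fun s1 h1 h1' => ?_)
      · simp [Expr.eval, h0', hN, Data.tl, enc_pair]
      · simp only [Expr.cost, Expr.eval, h0', hN, Data.tl, Data.size, sz]
        omega
      · refine (hc st hst.2.2 s1 h1).mono le_rfl fun s2 ⟨h2, h2'⟩ => ⟨h2, ?_⟩
        rw [h2' _ (by omega), h1' _ (by omega), hN]
    obtain ⟨s1, k1, hk1, hk1', hs1, hs1'⟩ := hassign
    have hbody := Exec.seq (Exec.emit (.tl (.hd (.var 0))) s) hk1
    obtain ⟨s', k, L, hL1, hL2, hL3⟩ := ih (advance DM I st) hst.2.2.advance (fun n hn => by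
      cases h : advance DM I st with
      | nil => simp [h] at hn
      | cons n' st' =>
        rw [h, List.head?_cons, Option.mem_some_iff] at hn
        exact hn ▸ advance_top hI hO hst.2.2 h) ((stackRows_advance st).trans hrows') s1 hs1 hs1'
    refine ⟨s', _, _, .while_true ?_ hbody hL1, ?_, fun a b hab => ?_⟩
    · rw [Expr.eval, h0']
      exact fun h => by cases h
    · rw [List.map_append, Output.map_snd_delay, Output.map_snd_delay, hL2, e1]
      rfl
    · have := hL3 (a + ((Expr.var 0).cost s + ((Expr.tl (.hd (.var 0))).cost s + k1)))
        (a + ((Expr.var 0).cost s + (Expr.tl (.hd (.var 0))).cost s)) (by omega)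
      rw [Output.delay_append, Output.delay_delay, Output.delay_delay]
      simp only [Output.delay, List.map_nil, List.append_nil, List.map_cons, List.cons_append,
        List.nil_append, List.isChain_cons_cons] at this ⊢
      refine ⟨by omega, ?_⟩
      simp only [Nat.add_assoc] at this ⊢
      exact this

theorem solvableWPD_of_tpCovered (DM : DecompositionMethod) :
    SolvableWPD fun I => TPCovered DM I.A (drv I.A) ∧ I.O ⊆ drv I.A := by
  obtain ⟨c, n, S, hS, H⟩ := PolyTime.advance_initStack DM
  obtain ⟨d, m, T, ⟨q, hq⟩, K⟩ := PolyTime.advance DM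
  set N := max n m with hN
  let t : Instance → ℕ := fun I => q.eval (1 + sz I + stackBound I)
  let m₂ : Instance → ℕ := fun I => 1 + 2 * sz I + 4 * stackBound I + t I + (sz I + S I)
  have hm : PolyBd fun I => 4 * stackBound I + m₂ I := by
    have h := polyBd_stackBound
    have h1 : PolyBd fun I : Instance => sz I := .size
    have h2 : ∀ n : ℕ, PolyBd fun _ : Instance => n := .const
    exact ((h2 4).mul h).add (((((h2 1).add ((h2 2).mul h1)).add ((h2 4).mul h)).add
      ((((h2 1).add h1).add h).eval q)).add (h1.add hS))
  obtain ⟨p, hp⟩ := hm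
  refine ⟨.seq (.seq (.assign (N + 1) (.var 0)) c) (.while (.var 0) (loopBody N d)), p, ?_⟩
  rintro I ⟨hI, hO⟩
  have hinit : Runs (.seq (.assign (N + 1) (.var 0)) c) (initStore (encInstance I)) (sz I + S I)
      fun s' => s' 0 = enc (advance DM I (initStack DM I)) ∧ s' (N + 1) = enc I := by
    refine .seq (.assign (enc I) (by simp [Expr.eval, initStore, enc])
      (by simp [Expr.cost, initStore, sz, enc]) fun s1 h1 h1' => ?_)
    refine ((H I).2 s1 ?_).mono le_rfl fun s2 ⟨h2, h2'⟩ => ⟨h2, ?_⟩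
    · rw [h1' _ (by omega), initStore, Function.update_self]
      rfl
    · rw [h2' _ (by omega), h1]
  obtain ⟨s1, k1, hk1, hk1', hs1, hs1'⟩ := hinit
  have hg := goodStack_initStack (DM := DM) (I := I)
  obtain ⟨s', k, L, hL1, hL2, hL3⟩ := exec_loop hI hO (c := d) (N := N) (t := t I)
    (m₁ := 4 * stackBound I) (m₂ := m₂ I) (fun st hst s hs => by
      refine ((K ⟨(I, st), hst⟩).2 s hs).mono ((hq _).trans (eval_mono q ?_)) fun s' ⟨h1, h2⟩ =>
        ⟨h1, fun y hy => h2 y (by omega)⟩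
      change sz (I, st) ≤ _
      rw [sz_pair]
      exact Nat.add_le_add_left hst.sz_le _) le_rfl (Nat.le_add_right _ _)
    (stackRows DM I (initStack DM I)) (advance DM I (initStack DM I)) hg.advance (fun n hn => by
      cases h : advance DM I (initStack DM I) with
      | nil => simp [h] at hn
      | cons n' st' =>
        rw [h, List.head?_cons, Option.mem_some_iff] at hn
        exact hn ▸ advance_top hI hO hg h) (stackRows_advance _) s1 hs1 hs1'
  have hinj : (enc : Row → Data).Injective := by
    refine encList_injective ?_
    intro x y h
    obtain ⟨h1, h2⟩ := Data.cons.inj h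
    exact Prod.ext (encNat_injective h1) (encNat_injective h2)
  have hsnd : (([] ++ L.delay k1 : Output)).map Prod.snd = (stackRows DM I (initStack DM I)).map enc := by
    rw [List.nil_append, Output.map_snd_delay, hL2]
  refine ⟨s', _, _, .seq hk1 hL1, ?_, fun d => ?_, ?_⟩
  · rw [hsnd]
    exact (stackRows_initStack_nodup hI hO).map hinj
  · rw [hsnd, List.mem_map]
    simp only [mem_stackRows_initStack hI hO]
    rfl
  · refine (hL3 k1 0 ?_).imp fun u v huv => huv.trans (Nat.add_le_add_left (hp I) _)
    have : sz I + S I ≤ m₂ I := Nat.le_add_left _ _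
    omega

end ECSP

theorem mainTheorem8 (DM : ECSP.DecompositionMethod) (𝒜 : Set ECSP.Str)
    (h𝒜 : ∀ A ∈ 𝒜, ECSP.TPCovered DM A (ECSP.drv A)) :
    ECSP.SolvableWPD (fun I => I.A ∈ 𝒜 ∧ I.O ⊆ ECSP.drv I.A) := by
  obtain ⟨c, p, h⟩ := ECSP.solvableWPD_of_tpCovered DM
  exact ⟨c, p, fun I hI => h I ⟨h𝒜 _ hI.1, hI.2⟩⟩
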